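/- All groups are discrete. A group $R$ is *rational* if $g\mapsto g^n$ is a bijection of $R$ for every $n\ge 1$. $\mathrm{Bau}(G)$ denotes the Baumslag rationalization of $G$, i.e. the universal (initial) homomorphism $G\to \mathrm{Bau}(G)$ to a rational group; for a nilpotent group $N$, $N\otimes\mathbb Q$ denotes its Malcev completion, i.e. the universal homomorphism $N\to N\otimes\mathbb Q$ to a rational nilpotent group; for abelian $N$ this is the usual tensor product. With the lower central series $G_1=G$, $G_{n+1}=[G_n,G]$, the $\mathbb Q$-completion of $G$ is $\widehat G_{\mathbb Q}=\varprojlim_n\,(G/G_n\otimes\mathbb Q)$. The rational lower central series is $G^{\mathbb Q}_1=G$, $G^{\mathbb Q}_{n+1}=\operatorname{Ker}\big(G^{\mathbb Q}_n\to (G^{\mathbb Q}_n/[G^{\mathbb Q}_n,G])\otimes\mathbb Q\big)$. A homomorphism $f:A\to B$ is *rationally $2$-acyclic* if $H_1(A,\mathbb Q)\to H_1(B,\mathbb Q)$ is an isomorphism and $H_2(A,\mathbb Q)\to H_2(B,\mathbb Q)$ is surjective. A group $L$ is *$H\mathbb Q$-local* if $f^*:\mathrm{Hom}(B,L)\to\mathrm{Hom}(A,L)$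 is bijective for every rationally $2$-acyclic $f:A\to B$. An *$H\mathbb Q$-localization* of $G$ is a rationally $2$-acyclic homomorphism from $G$ to an $H\mathbb Q$-local group. **Theorem.** 1. Every $H\mathbb Q$-local group is rational. 2. Every rational nilpotent group is $H\mathbb Q$-local; every limit (in particular every inverse limit) of rational nilpotent groups is $H\mathbb Q$-local; and $\widehat G_{\mathbb Q}$ is $H\mathbb Q$-local for every group $G$. 3. There is an $H\mathbb Q$-localization functor, that is, a functor $\ell_{H\mathbb Q}$ from groups to groups with a natural transformation $\eta:\mathrm{Id}\to\ell_{H\mathbb Q}$ all of whose components are $H\mathbb Q$-localizations. For every such $(\ell_{H\mathbb Q},\eta)$ there are unique natural transformations $$\mathrm{Bau}(G)\longrightarrow \ell_{H\mathbb Q}(G)\longrightarrow \widehat G_{\mathbb Q}$$ that are compatible with the canonical homomorphisms from $G$ to the three groups. 4. If $H_1(G,\mathbb Q)$ is finite dimensional, then $\ell_{H\mathbb Q}(G)\to\widehat G_{\mathbb Q}$ is surjective and its kernel is $\bigcap_{n\ge 1}\big(\ell_{H\mathbb Q}(G)\big)^{\mathbb Q}_n$. -/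

import Mathlib

open CategoryTheory
open scoped TensorProduct commutatorElement

universe u v w

namespace RatGrp

/-! ### Rational groups -/

/-- A group is rational (uniquely divisible) if `g ↦ g ^ n` is bijective for every `n ≥ 1`. -/
def IsRational (G : Type u) [Group G] : Prop :=
  ∀ n : ℕ, 1 ≤ n → Function.Bijective fun g : G => g ^ n

/-- A Baumslag rationalization: a universal homomorphism to a rational group. -/
def IsBaumslagRationalization {G B : Type u} [Group G] [Group B] (η : G →* B) : Prop :=
  IsRational B ∧ ∀ (R : Type u) [Group R], IsRational R → ∀ φ : G →* R,
    ∃! ψ : B →* R, ψ.comp η = φ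

/-- A Malcev completion: a universal homomorphism to a rational nilpotent group. -/
def IsMalcevCompletion {N M : Type u} [Group N] [Group M] (η : N →* M) : Prop :=
  Group.IsNilpotent M ∧ IsRational M ∧
    ∀ (R : Type u) [Group R], Group.IsNilpotent R → IsRational R → ∀ φ : N →* R,
      ∃! ψ : M →* R, ψ.comp η = φ

/-! ### The Baumslag rationalization, built from words with roots -/

/-- Formal expressions in elements of `G`, the group operations and formal roots;
`root n t` stands for the `(n + 1)`-st root of `t`. -/
inductive BauTerm (G : Type u) : Type u
  | of (g : G) : BauTerm G
  | one : BauTerm G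
  | mul (a b : BauTerm G) : BauTerm G
  | inv (a : BauTerm G) : BauTerm G
  | root (n : ℕ) (a : BauTerm G) : BauTerm G

/-- The formal power `a * a * ⋯ * a`. -/
def BauTerm.pow {G : Type u} (a : BauTerm G) : ℕ → BauTerm G
  | 0 => .one
  | n + 1 => .mul (BauTerm.pow a n) a

/-- The least congruence making expressions into a group with unique roots receiving a
homomorphism from `G`. -/
inductive BauRel (G : Type u) [Group G] : BauTerm G → BauTerm G → Prop
  | refl (a) : BauRel G a a
  | symm {a b} : BauRel G a b → BauRel G b a
  | trans {a b c} : BauRel G a b → BauRel G b c → BauRel G a c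
  | mul_congr {a a' b b'} : BauRel G a a' → BauRel G b b' → BauRel G (.mul a b) (.mul a' b')
  | inv_congr {a a'} : BauRel G a a' → BauRel G (.inv a) (.inv a')
  | root_congr (n) {a a'} : BauRel G a a' → BauRel G (.root n a) (.root n a')
  | mul_assoc (a b c) : BauRel G (.mul (.mul a b) c) (.mul a (.mul b c))
  | one_mul (a) : BauRel G (.mul .one a) a
  | mul_one (a) : BauRel G (.mul a .one) a
  | inv_mul (a) : BauRel G (.mul (.inv a) a) .one
  | of_mul (g h : G) : BauRel G (.of (g * h)) (.mul (.of g) (.of h))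
  | root_pow (n a) : BauRel G (BauTerm.pow (.root n a) (n + 1)) a
  | pow_root (n a) : BauRel G (.root n (BauTerm.pow a (n + 1))) a

/-- The setoid of the congruence `BauRel`. -/
def bauSetoid (G : Type u) [Group G] : Setoid (BauTerm G) where
  r := BauRel G
  iseqv := ⟨.refl, .symm, .trans⟩

/-- The Baumslag rationalization of a group. -/
def Bau (G : Type u) [Group G] : Type u := Quotient (bauSetoid G)

namespace Bau

instance instGroup (G : Type u) [Group G] : Group (Bau G) where
  mul := Quotient.map₂ BauTerm.mul fun _ _ h _ _ h' => BauRel.mul_congr h h'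
  one := Quotient.mk _ .one
  inv := Quotient.map BauTerm.inv fun _ _ h => BauRel.inv_congr h
  mul_assoc := by
    rintro ⟨a⟩ ⟨b⟩ ⟨c⟩
    exact Quotient.sound (BauRel.mul_assoc a b c)
  one_mul := by
    rintro ⟨a⟩
    exact Quotient.sound (BauRel.one_mul a)
  mul_one := by
    rintro ⟨a⟩
    exact Quotient.sound (BauRel.mul_one a)
  inv_mul_cancel := by
    rintro ⟨a⟩
    exact Quotient.sound (BauRel.inv_mul a)

variable {G : Type u} [Group G]

/-- The class of an expression. -/
def mk (a : BauTerm G) : Bau G := Quotient.mk (bauSetoid G) a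

theorem mk_pow (a : BauTerm G) (n : ℕ) : mk (a.pow n) = mk a ^ n := by
  induction n with
  | zero => rfl
  | succ n ih => rw [pow_succ, ← ih]; rfl

/-- The canonical homomorphism from a group to its Baumslag rationalization. -/
def of (G : Type u) [Group G] : G →* Bau G :=
  MonoidHom.mk' (fun g => mk (.of g)) fun g h => Quotient.sound (BauRel.of_mul g h)

theorem isRational (G : Type u) [Group G] : IsRational (Bau G) := by
  intro n hn
  obtain ⟨n, rfl⟩ : ∃ m, n = m + 1 := ⟨n - 1, by omega⟩
  constructor
  · rintro ⟨a⟩ ⟨b⟩ h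
    have h' : mk (a.pow (n + 1)) = mk (b.pow (n + 1)) := by
      rw [mk_pow, mk_pow]; exact h
    have h2 : BauRel G (a.pow (n + 1)) (b.pow (n + 1)) := Quotient.exact h'
    exact Quotient.sound
      (((BauRel.pow_root n a).symm.trans (h2.root_congr n)).trans (BauRel.pow_root n b))
  · rintro ⟨a⟩
    refine ⟨mk (.root n a), ?_⟩
    change mk (.root n a) ^ (n + 1) = mk a
    rw [← mk_pow]
    exact Quotient.sound (BauRel.root_pow n a)

/-- The value of an expression in a rational group. -/
noncomputable def eval {R : Type v} [Group R] (hR : IsRational R) (φ : G →* R) :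
    BauTerm G → R
  | .of g => φ g
  | .one => 1
  | .mul a b => eval hR φ a * eval hR φ b
  | .inv a => (eval hR φ a)⁻¹
  | .root n a => Function.surjInv (hR (n + 1) (Nat.le_add_left 1 n)).2 (eval hR φ a)

theorem eval_pow {R : Type v} [Group R] (hR : IsRational R) (φ : G →* R) (a : BauTerm G)
    (n : ℕ) : eval hR φ (a.pow n) = eval hR φ a ^ n := by
  induction n with
  | zero => rw [pow_zero]; rfl
  | succ n ih => rw [pow_succ, ← ih]; rfl

theorem eval_congr {R : Type v} [Group R] (hR : IsRational R) (φ : G →* R)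
    {a b : BauTerm G} (h : BauRel G a b) : eval hR φ a = eval hR φ b := by
  induction h with
  | refl a => rfl
  | symm _ ih => exact ih.symm
  | trans _ _ ih ih' => exact ih.trans ih'
  | mul_congr _ _ ih ih' => simp only [eval, ih, ih']
  | inv_congr _ ih => simp only [eval, ih]
  | root_congr n _ ih => simp only [eval, ih]
  | mul_assoc a b c => simp only [eval, _root_.mul_assoc]
  | one_mul a => simp only [eval, _root_.one_mul]
  | mul_one a => simp only [eval, _root_.mul_one]
  | inv_mul a => simp only [eval, inv_mul_cancel]
  | of_mul g h => simp only [eval, map_mul]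
  | root_pow n a =>
    rw [eval_pow]
    exact Function.surjInv_eq (hR (n + 1) (Nat.le_add_left 1 n)).2 (eval hR φ a)
  | pow_root n a =>
    apply (hR (n + 1) (Nat.le_add_left 1 n)).1
    change (Function.surjInv (hR (n + 1) (Nat.le_add_left 1 n)).2
      (eval hR φ (a.pow (n + 1)))) ^ (n + 1) = eval hR φ a ^ (n + 1)
    rw [← eval_pow]
    exact Function.surjInv_eq (hR (n + 1) (Nat.le_add_left 1 n)).2 _

/-- The extension of a homomorphism to a rational group along `Bau.of`. -/
noncomputable def lift {R : Type v} [Group R] (hR : IsRational R) (φ : G →* R) : Bau G →* R :=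
  MonoidHom.mk' (Quotient.lift (eval hR φ) fun _ _ h => eval_congr hR φ h) (by
    rintro ⟨a⟩ ⟨b⟩
    rfl)

theorem lift_comp_of {R : Type v} [Group R] (hR : IsRational R) (φ : G →* R) :
    (lift hR φ).comp (of G) = φ := rfl

/-- The only root-closed subgroup of `Bau G` containing the image of `G` is `Bau G`. -/
theorem eq_top_of_rootClosed (T : Subgroup (Bau G)) (hT : (of G).range ≤ T)
    (hroot : ∀ (n : ℕ) (x : Bau G), x ^ (n + 1) ∈ T → x ∈ T) : T = ⊤ := by
  rw [eq_top_iff]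
  rintro ⟨a⟩ -
  change mk a ∈ T
  induction a with
  | of g => exact hT ⟨g, rfl⟩
  | one => exact T.one_mem
  | mul a b iha ihb => exact T.mul_mem iha ihb
  | inv a ih => exact T.inv_mem ih
  | root n a ih =>
    apply hroot n
    rw [← mk_pow]
    have : mk (BauTerm.pow (.root n a) (n + 1)) = mk a := Quotient.sound (BauRel.root_pow n a)
    rw [this]
    exact ih

theorem hom_ext {R : Type v} [Group R] (hR : IsRational R) {f g : Bau G →* R}
    (h : f.comp (of G) = g.comp (of G)) : f = g := by
  have : f.eqLocus g = ⊤ := by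
    apply eq_top_of_rootClosed
    · rintro _ ⟨x, rfl⟩
      exact DFunLike.congr_fun h x
    · intro n x hx
      have hx' : f (x ^ (n + 1)) = g (x ^ (n + 1)) := hx
      rw [map_pow, map_pow] at hx'
      exact (hR (n + 1) (Nat.le_add_left 1 n)).1 hx'
  ext x
  have hx : x ∈ f.eqLocus g := by rw [this]; trivial
  exact hx

theorem isBaumslagRationalization (G : Type u) [Group G] :
    IsBaumslagRationalization (of G) :=
  ⟨isRational G, fun _ _ hR φ => ⟨lift hR φ, lift_comp_of hR φ, fun _ hψ =>
    hom_ext hR (hψ.trans (lift_comp_of hR φ).symm)⟩⟩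

/-- Functoriality of the Baumslag rationalization. -/
noncomputable def map {H : Type v} [Group H] (f : G →* H) : Bau G →* Bau H :=
  lift (isRational H) ((of H).comp f)

theorem map_of {H : Type v} [Group H] (f : G →* H) (x : G) : map f (of G x) = of H (f x) := rfl

theorem map_id (G : Type u) [Group G] : map (MonoidHom.id G) = MonoidHom.id (Bau G) :=
  hom_ext (isRational G) rfl

theorem map_comp {H : Type v} {K : Type w} [Group H] [Group K] (g : H →* K) (f : G →* H) :
    map (g.comp f) = (map g).comp (map f) :=
  hom_ext (isRational K) rfl

theorem map_map {H : Type v} {K : Type w} [Group H] [Group K] (g : H →* K) (f : G →* H)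
    (x : Bau G) : map g (map f x) = map (g.comp f) x := by
  rw [map_comp]; rfl

end Bau

/-- The Baumslag rationalization as a functor. -/
noncomputable def bau : GrpCat.{u} ⥤ GrpCat.{u} where
  obj G := GrpCat.of (Bau G)
  map f := GrpCat.ofHom (Bau.map f.hom)
  map_id G := by
    apply GrpCat.hom_ext
    exact Bau.map_id G
  map_comp f g := by
    apply GrpCat.hom_ext
    exact Bau.map_comp g.hom f.hom

/-- The coaugmentation `G → Bau G`. -/
noncomputable def bauUnit : 𝟭 GrpCat.{u} ⟶ bau.{u} where
  app G := GrpCat.ofHom (Bau.of G)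
  naturality _ _ _ := rfl

/-! ### The Malcev completion of nilpotent groups -/

/-- If the only root-closed subgroup of a rational group `R` containing `S` is `R`, and `S` is
nilpotent, then `R` is nilpotent, of the same class. -/
theorem lowerCentralSeries_eq_bot_of_rootClosure (c : ℕ) :
    ∀ (R : Type u) [Group R], IsRational R → ∀ S : Subgroup R,
      (∀ T : Subgroup R, S ≤ T → (∀ (n : ℕ) (x : R), x ^ (n + 1) ∈ T → x ∈ T) → T = ⊤) →
      S.lowerCentralSeries c = ⊥ → (⊤ : Subgroup R).lowerCentralSeries c = ⊥ := by
  induction c with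
  | zero =>
    intro R _ hR S hS hc
    have hc' : S = ⊥ := hc
    have : (⊥ : Subgroup R) = ⊤ := by
      refine hS ⊥ hc'.le fun n x hx => ?_
      rw [Subgroup.mem_bot] at hx ⊢
      exact (hR (n + 1) (Nat.le_add_left 1 n)).1 (by simpa using hx)
    exact this.symm
  | succ c ih =>
    intro R _ hR S hS hc
    have hcent : S.lowerCentralSeries c ≤ Subgroup.center R := by
      intro s hs
      have htop : Subgroup.centralizer {s} = ⊤ := by
        refine hS _ ?_ ?_
        · intro t ht
          rw [Subgroup.mem_centralizer_singleton_iff]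
          have h1 : ⁅s, t⁆ ∈ S.lowerCentralSeries (c + 1) :=
            Subgroup.commutator_mem_commutator hs ht
          rw [hc, Subgroup.mem_bot, commutatorElement_eq_one_iff_mul_comm] at h1
          exact h1.symm
        · intro n x hx
          rw [Subgroup.mem_centralizer_singleton_iff] at hx ⊢
          have h2 : (s⁻¹ * x * s) ^ (n + 1) = x ^ (n + 1) := by
            have := conj_pow (i := n + 1) (a := s⁻¹) (b := x)
            rw [inv_inv] at this
            rw [this, mul_assoc, hx, inv_mul_cancel_left]
          have h3 : s⁻¹ * x * s = x := (hR (n + 1) (Nat.le_add_left 1 n)).1 h2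
          rw [mul_assoc, inv_mul_eq_iff_eq_mul] at h3
          exact h3
      rw [Subgroup.mem_center_iff]
      intro g
      have hg : g ∈ Subgroup.centralizer {s} := by rw [htop]; trivial
      exact Subgroup.mem_centralizer_singleton_iff.1 hg
    have hroot : ∀ (n : ℕ) (z : R), z ^ (n + 1) ∈ Subgroup.center R →
        z ∈ Subgroup.center R := by
      intro n z hz
      rw [Subgroup.mem_center_iff] at hz ⊢
      intro g
      have h2 : (g * z * g⁻¹) ^ (n + 1) = z ^ (n + 1) := by
        rw [conj_pow, hz g, mul_inv_cancel_right]
      have h3 : g * z * g⁻¹ = z := (hR (n + 1) (Nat.le_add_left 1 n)).1 h2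
      exact mul_inv_eq_iff_eq_mul.1 h3
    have hQ : IsRational (R ⧸ Subgroup.center R) := by
      intro n hn
      obtain ⟨n, rfl⟩ : ∃ m, n = m + 1 := ⟨n - 1, by omega⟩
      constructor
      · intro x y
        induction x using QuotientGroup.induction_on with | H x => ?_
        induction y using QuotientGroup.induction_on with | H y => ?_
        intro hxy
        have h1 : (x ^ (n + 1))⁻¹ * y ^ (n + 1) ∈ Subgroup.center R := by
          rw [← QuotientGroup.eq]; exact hxy
        obtain ⟨z, hz⟩ := (hR (n + 1) hn).2 ((x ^ (n + 1))⁻¹ * y ^ (n + 1))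
        have hz' : z ^ (n + 1) = (x ^ (n + 1))⁻¹ * y ^ (n + 1) := hz
        have hzc : z ∈ Subgroup.center R := hroot n z (hz' ▸ h1)
        have hcomm : Commute x z := Subgroup.mem_center_iff.1 hzc x
        have h4 : x * z = y := by
          apply (hR (n + 1) hn).1
          change (x * z) ^ (n + 1) = y ^ (n + 1)
          rw [hcomm.mul_pow, hz', mul_inv_cancel_left]
        rw [QuotientGroup.eq, ← h4, inv_mul_cancel_left]
        exact hzc
      · intro x
        induction x using QuotientGroup.induction_on with | H x => ?_
        obtain ⟨y, hy⟩ := (hR (n + 1) hn).2 x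
        exact ⟨(y : R ⧸ Subgroup.center R), congrArg _ hy⟩
    have key := ih (R ⧸ Subgroup.center R) hQ (S.map (QuotientGroup.mk' (Subgroup.center R)))
      (by
        intro T hT hTr
        have h5 := hS (T.comap (QuotientGroup.mk' (Subgroup.center R)))
          (Subgroup.map_le_iff_le_comap.1 hT) (fun n x hx => hTr n _ hx)
        rw [eq_top_iff]
        intro x _
        obtain ⟨x, rfl⟩ := QuotientGroup.mk'_surjective _ x
        have : x ∈ T.comap (QuotientGroup.mk' (Subgroup.center R)) := by rw [h5]; trivial
        exact this)
      (by
        rw [← Subgroup.map_lowerCentralSeries, Subgroup.map_eq_bot_iff, QuotientGroup.ker_mk']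
        have hc' : S.lowerCentralSeries c ≤ Subgroup.center R := hcent
        exact hc')
    apply Subgroup.lowerCentralSeries_succ_eq_bot
    have h6 : ((⊤ : Subgroup R).map (QuotientGroup.mk' (Subgroup.center R))) = ⊤ :=
      Subgroup.map_top_of_surjective _ (QuotientGroup.mk'_surjective _)
    rw [← h6, ← Subgroup.map_lowerCentralSeries, Subgroup.map_eq_bot_iff,
      QuotientGroup.ker_mk'] at key
    exact key

/-- The Baumslag rationalization of a nilpotent group is nilpotent. -/
theorem Bau.isNilpotent (N : Type u) [Group N] [Group.IsNilpotent N] :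
    Group.IsNilpotent (Bau N) := by
  obtain ⟨c, hc⟩ := Subgroup.nilpotent_iff_lowerCentralSeries.1 (inferInstance : Group.IsNilpotent N)
  refine Subgroup.nilpotent_iff_lowerCentralSeries.2 ⟨c,
    lowerCentralSeries_eq_bot_of_rootClosure c (Bau N) (Bau.isRational N) (Bau.of N).range
      Bau.eq_top_of_rootClosed ?_⟩
  rw [MonoidHom.range_eq_map, ← Subgroup.map_lowerCentralSeries, hc, Subgroup.map_bot]

/-- The Malcev completion `N ⊗ ℚ` of a nilpotent group `N`. It is realized by `Bau N`, which is
the universal homomorphism to a rational nilpotent group by `isMalcevCompletion_of`. -/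
abbrev MalcevCompletion (N : Type u) [Group N] [Group.IsNilpotent N] : Type u := Bau N

theorem isMalcevCompletion_of (N : Type u) [Group N] [Group.IsNilpotent N] :
    IsMalcevCompletion (Bau.of N : N →* MalcevCompletion N) :=
  ⟨Bau.isNilpotent N, Bau.isRational N, fun R _ _ hR φ =>
    (Bau.isBaumslagRationalization N).2 R hR φ⟩

/-! ### The `ℚ`-completion -/

/-- The nilpotent quotient `G / γₙ`, where `γ₀ = G` and `γₙ₊₁ = [γₙ, G]`. -/
abbrev NilQuot (G : Type u) [Group G] (n : ℕ) : Type u :=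
  G ⧸ (⊤ : Subgroup G).lowerCentralSeries n

instance NilQuot.isNilpotent (G : Type u) [Group G] (n : ℕ) :
    Group.IsNilpotent (NilQuot G n) := by
  refine Subgroup.nilpotent_iff_lowerCentralSeries.2 ⟨n, ?_⟩
  rw [← Subgroup.map_top_of_surjective _
    (QuotientGroup.mk'_surjective ((⊤ : Subgroup G).lowerCentralSeries n)),
    ← Subgroup.map_lowerCentralSeries, Subgroup.map_eq_bot_iff, QuotientGroup.ker_mk']

/-- The projection `G / γₙ₊₁ → G / γₙ`. -/
def NilQuot.proj (G : Type u) [Group G] (n : ℕ) : NilQuot G (n + 1) →* NilQuot G n :=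
  QuotientGroup.map _ _ (MonoidHom.id G)
    (Subgroup.lowerCentralSeries_antitone (⊤ : Subgroup G) (Nat.le_succ n))

/-- The homomorphism `G / γₙ → H / γₙ` induced by `f : G → H`. -/
def NilQuot.map {G : Type u} {H : Type v} [Group G] [Group H] (f : G →* H) (n : ℕ) :
    NilQuot G n →* NilQuot H n :=
  QuotientGroup.map _ _ f (by
    rw [← Subgroup.map_le_iff_le_comap, Subgroup.map_lowerCentralSeries]
    exact Subgroup.lowerCentralSeries_mono n le_top)

/-- The `ℚ`-completion, the inverse limit of the tower of Malcev completions `G / γₙ ⊗ ℚ`,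
as a subgroup of their product. -/
def qCompletionSubgroup (G : Type u) [Group G] :
    Subgroup (∀ n : ℕ, MalcevCompletion (NilQuot G n)) where
  carrier := {x | ∀ n, Bau.map (NilQuot.proj G n) (x (n + 1)) = x n}
  mul_mem' hx hy n := by rw [Pi.mul_apply, map_mul, hx n, hy n, Pi.mul_apply]
  one_mem' n := by rw [Pi.one_apply, map_one, Pi.one_apply]
  inv_mem' hx n := by rw [Pi.inv_apply, map_inv, hx n, Pi.inv_apply]

/-- The `ℚ`-completion of a group. -/
abbrev QCompletion (G : Type u) [Group G] : Type u := qCompletionSubgroup G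

/-- The canonical homomorphism from a group to its `ℚ`-completion. -/
def QCompletion.of (G : Type u) [Group G] : G →* QCompletion G where
  toFun g := ⟨fun n => Bau.of (NilQuot G n) (QuotientGroup.mk g), fun _ => rfl⟩
  map_one' := by
    ext n
    change Bau.of (NilQuot G n) 1 = 1
    exact map_one _
  map_mul' g h := by
    ext n
    change Bau.of (NilQuot G n) (QuotientGroup.mk g * QuotientGroup.mk h) = _
    exact map_mul _ _ _

/-- Functoriality of the `ℚ`-completion. -/
noncomputable def QCompletion.map {G : Type u} {H : Type v} [Group G] [Group H] (f : G →* H) :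
    QCompletion G →* QCompletion H where
  toFun x := ⟨fun n => Bau.map (NilQuot.map f n) (x.1 n), fun n => by
    change Bau.map (NilQuot.proj H n) (Bau.map (NilQuot.map f (n + 1)) (x.1 (n + 1))) =
      Bau.map (NilQuot.map f n) (x.1 n)
    rw [← x.2 n, Bau.map_map, Bau.map_map]
    congr 2
    ext g
    rfl⟩
  map_one' := by
    ext n
    exact map_one (Bau.map (NilQuot.map f n))
  map_mul' x y := by
    ext n
    exact map_mul (Bau.map (NilQuot.map f n)) _ _

/-- The `ℚ`-completion as a functor. -/
noncomputable def qCompletion : GrpCat.{u} ⥤ GrpCat.{u} where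
  obj G := GrpCat.of (QCompletion G)
  map f := GrpCat.ofHom (QCompletion.map f.hom)
  map_id G := by
    apply GrpCat.hom_ext
    ext x n
    change Bau.map (NilQuot.map (MonoidHom.id G) n) (x.1 n) = x.1 n
    have : NilQuot.map (MonoidHom.id G) n = MonoidHom.id _ := QuotientGroup.map_id _
    rw [this, Bau.map_id]
    rfl
  map_comp {G H K} f g := by
    apply GrpCat.hom_ext
    ext x n
    change Bau.map (NilQuot.map (g.hom.comp f.hom) n) (x.1 n) =
      Bau.map (NilQuot.map g.hom n) (Bau.map (NilQuot.map f.hom n) (x.1 n))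
    rw [Bau.map_map]
    congr 2
    ext y
    rfl

/-- The coaugmentation of the `ℚ`-completion. -/
noncomputable def qCompletionUnit : 𝟭 GrpCat.{u} ⟶ qCompletion.{u} where
  app G := GrpCat.ofHom (QCompletion.of G)
  naturality _ _ _ := rfl

/-! ### The rational lower central series -/

/-- The homomorphism `A → A ⊗ ℚ` of an abelian group `A`. -/
noncomputable def toRat (A : Type u) [CommGroup A] :
    A →* Multiplicative (ℚ ⊗[ℤ] Additive A) :=
  AddMonoidHom.toMultiplicativeRight
    (TensorProduct.mk ℤ ℚ (Additive A) 1).toAddMonoidHom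

theorem toRat_eq_one_iff {A : Type u} [CommGroup A] (a : A) :
    toRat A a = 1 ↔ ∃ m : ℕ, 1 ≤ m ∧ a ^ m = 1 := by
  have : IsLocalizedModule (nonZeroDivisors ℤ) (TensorProduct.mk ℤ ℚ (Additive A) 1) :=
    (isLocalizedModule_iff_isBaseChange (nonZeroDivisors ℤ) ℚ _).2
      (TensorProduct.isBaseChange ℤ (Additive A) ℚ)
  have h := IsLocalizedModule.eq_zero_iff (nonZeroDivisors ℤ)
    (TensorProduct.mk ℤ ℚ (Additive A) 1) (m := Additive.ofMul a)
  refine Iff.trans h ⟨?_, ?_⟩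
  · rintro ⟨⟨s, hs⟩, h1⟩
    refine ⟨s.natAbs, Int.natAbs_pos.2 (nonZeroDivisors.ne_zero hs), ?_⟩
    have h2 : a ^ s = 1 := h1
    rcases Int.natAbs_eq s with h3 | h3
    · rw [h3, zpow_natCast] at h2
      exact h2
    · rw [h3, zpow_neg, zpow_natCast, inv_eq_one] at h2
      exact h2
  · rintro ⟨m, hm, h1⟩
    refine ⟨⟨(m : ℤ), mem_nonZeroDivisors_of_ne_zero (by omega)⟩, ?_⟩
    have : a ^ (m : ℤ) = 1 := by rw [zpow_natCast]; exact h1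
    exact this

section ratStep

variable {G : Type u} [Group G] (H : Subgroup G) [H.Normal]

/-- The abelian group structure on `H / [H, G]`. -/
@[reducible]
def commGroupQuot : CommGroup (H ⧸ (⁅H, (⊤ : Subgroup G)⁆).subgroupOf H) where
  mul_comm := by
    rintro ⟨a⟩ ⟨b⟩
    change ((a * b : H) : H ⧸ (⁅H, (⊤ : Subgroup G)⁆).subgroupOf H) = ((b * a : H) : _)
    rw [QuotientGroup.eq, Subgroup.mem_subgroupOf]
    have h : ⁅(b : G)⁻¹, (a : G)⁻¹⁆ ∈ ⁅H, (⊤ : Subgroup G)⁆ :=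
      Subgroup.commutator_mem_commutator (H.inv_mem b.2) trivial
    rw [commutatorElement_def] at h
    simpa [mul_assoc] using h

/-- The kernel of `H → H / [H, G] ⊗ ℚ`, as a subgroup of `G`. -/
noncomputable def ratStep : Subgroup G :=
  letI := commGroupQuot H
  ((toRat (H ⧸ (⁅H, (⊤ : Subgroup G)⁆).subgroupOf H)).comp (QuotientGroup.mk' _)).ker.map
    H.subtype

theorem mem_ratStep_iff (x : G) :
    x ∈ ratStep H ↔ x ∈ H ∧ ∃ m : ℕ, 1 ≤ m ∧ x ^ m ∈ ⁅H, (⊤ : Subgroup G)⁆ := by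
  let := commGroupQuot H
  have key : ∀ y : H, y ∈ ((toRat (H ⧸ (⁅H, (⊤ : Subgroup G)⁆).subgroupOf H)).comp
      (QuotientGroup.mk' _)).ker ↔ ∃ m : ℕ, 1 ≤ m ∧ (y : G) ^ m ∈ ⁅H, (⊤ : Subgroup G)⁆ := by
    intro y
    refine (toRat_eq_one_iff _).trans (exists_congr fun m => and_congr_right fun _ => ?_)
    change ((y ^ m : H) : H ⧸ (⁅H, (⊤ : Subgroup G)⁆).subgroupOf H) = 1 ↔ _
    rw [QuotientGroup.eq_one_iff, Subgroup.mem_subgroupOf]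
    rfl
  constructor
  · rintro ⟨y, hy, rfl⟩
    exact ⟨y.2, (key y).1 hy⟩
  · rintro ⟨hx, hm⟩
    exact ⟨⟨x, hx⟩, (key ⟨x, hx⟩).2 hm, rfl⟩

theorem ratStep_normal : (ratStep H).Normal := by
  refine ⟨fun x hx g => ?_⟩
  rw [mem_ratStep_iff] at hx ⊢
  obtain ⟨hxH, m, hm, hxm⟩ := hx
  refine ⟨Subgroup.Normal.conj_mem inferInstance x hxH g, m, hm, ?_⟩
  rw [conj_pow]
  exact Subgroup.Normal.conj_mem inferInstance _ hxm g

end ratStep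

/-- The rational lower central series as a sequence of normal subgroups. -/
noncomputable def ratSeries (G : Type u) [Group G] : ℕ → {H : Subgroup G // H.Normal}
  | 0 => ⟨⊤, inferInstance⟩
  | n + 1 =>
    haveI := (ratSeries G n).2
    ⟨ratStep (ratSeries G n).1, ratStep_normal _⟩

/-- The rational lower central series: `Γ₀ = G` and `Γₙ₊₁ = ker (Γₙ → Γₙ / [Γₙ, G] ⊗ ℚ)`. -/
noncomputable def rationalLowerCentralSeries (G : Type u) [Group G] (n : ℕ) : Subgroup G :=
  (ratSeries G n).1

/-! ### `Hℚ`-localization -/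

/-- Rational homology `Hₙ(G, ℚ)`; the coefficient field is lifted to the universe of `G`. -/
noncomputable abbrev rationalHomology (G : Type u) [Group G] (n : ℕ) :
    ModuleCat.{u} (ULift.{u} ℚ) :=
  groupHomology (Rep.trivial (ULift.{u} ℚ) G (ULift.{u} ℚ)) n

/-- The map `Hₙ(G, ℚ) → Hₙ(H, ℚ)` induced by `f : G → H`. -/
noncomputable abbrev rationalHomologyMap {G H : Type u} [Group G] [Group H] (f : G →* H)
    (n : ℕ) : rationalHomology G n ⟶ rationalHomology H n :=
  groupHomology.map (A := Rep.trivial (ULift.{u} ℚ) G (ULift.{u} ℚ))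
    (B := Rep.trivial (ULift.{u} ℚ) H (ULift.{u} ℚ)) f (𝟙 _) n

/-- Rationally 2-acyclic homomorphisms: isomorphism on `H₁(-, ℚ)`, epimorphism on `H₂(-, ℚ)`. -/
def IsHQMap {G H : Type u} [Group G] [Group H] (f : G →* H) : Prop :=
  Function.Bijective (rationalHomologyMap f 1) ∧ Function.Surjective (rationalHomologyMap f 2)

/-- A group is `Hℚ`-local if it is local with respect to all rationally 2-acyclic
homomorphisms. -/
def IsHQLocal (L : Type u) [Group L] : Prop :=
  ∀ (A B : Type u) [Group A] [Group B] (f : A →* B), IsHQMap f →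
    Function.Bijective fun ψ : B →* L => ψ.comp f

/-- An `Hℚ`-localization: a rationally 2-acyclic homomorphism to an `Hℚ`-local group. -/
def IsHQLocalization {G L : Type u} [Group G] [Group L] (η : G →* L) : Prop :=
  IsHQMap η ∧ IsHQLocal L

/-- A coaugmented functor `ℓ` with coaugmentation `η` is the `Hℚ`-localization functor if every
component of `η` is an `Hℚ`-localization. -/
def IsHQLocalizationFunctor (ℓ : GrpCat.{u} ⥤ GrpCat.{u}) (η : 𝟭 GrpCat.{u} ⟶ ℓ) : Prop :=
  ∀ G : GrpCat.{u}, IsHQLocalization (η.app G).hom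

end RatGrp

open RatGrp

/-! Everything rests on `isHQMap_iff_isOrtho`: a homomorphism is rationally 2-acyclic exactly when
it lifts uniquely against every central extension whose kernel is rational, i.e. a ℚ-vector space.
Such a lifting problem amounts to a 2-cocycle with a trivialisation over the source, so it is
governed by `H₁` and by the cokernel on `H₂`; conversely, universal choices of the vector space
recover these conditions. After this, homology is hardly needed.

Multiplication by `n ≥ 1` on the integers lifts in this sense, so local groups are rational. A
rational nilpotent group is reached from the trivial group by central extensions with rational
kernel, so it is local, and limits of local groups are local.

For a set of homomorphisms, terms with infinitary operations yield a reflection onto the groups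
local for that set (`exists_reflection`). If the given homomorphisms are rationally 2-acyclic, a
pullback argument shows that the unit is too (`isHQMap_of_reflection`). A set suffices: by a
Löwenheim–Skolem argument (`exists_countable_isHQMap`) every rationally 2-acyclic map is exhausted
by countable ones, and countable groups are quotients of one free group.

The two natural transformations come from universal properties. With `L` the localization, each
stage `L → G/γₙ ⊗ ℚ` is onto with kernel the rational lower central term `Γₙ` of `L`
(`stage_surjective`, `stage_ker`); this gives the kernel of the map `β` to the completion.

For surjectivity, finitely many elements `gᵢ` generate up to roots and commutators. Successive
approximation writes every `y` in the completion as `β(x) ∏ [sᵢ, β(gᵢ)]` with `x` in `L` and `sᵢ`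
again in the completion (`exists_eq_commProd`). This is one system of equations indexed by all
elements of the completion. Local groups solve such systems uniquely
(`IsHQLocal.existsUnique_solution`), because adjoining a solution is rationally 2-acyclic. The image
under `β` of the solution in `L` and the tautological solution `y ↦ y` both solve it in the
completion, so they coincide. -/

namespace RatGrp

/-! ### Rationally acyclic homomorphisms in terms of chains -/

/-- The rational numbers, lifted to the universe `u`. -/
abbrev QQ : Type u := ULift.{u} ℚ

section chains

variable (G : Type u) [Group G]

/-- The boundary of rational `2`-chains of a group. -/
noncomputable def bd₂ : (G × G →₀ QQ.{u}) →ₗ[QQ.{u}] (G →₀ QQ.{u}) :=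
  Finsupp.linearCombination _ fun g =>
    Finsupp.single g.2 1 - Finsupp.single (g.1 * g.2) 1 + Finsupp.single g.1 1

/-- The boundary of rational `3`-chains of a group. -/
noncomputable def bd₃ : (G × G × G →₀ QQ.{u}) →ₗ[QQ.{u}] (G × G →₀ QQ.{u}) :=
  Finsupp.linearCombination _ fun g =>
    Finsupp.single (g.2.1, g.2.2) 1 - Finsupp.single (g.1 * g.2.1, g.2.2) 1 +
      Finsupp.single (g.1, g.2.1 * g.2.2) 1 - Finsupp.single (g.1, g.2.1) 1

theorem bd₂_single (g h : G) (a : QQ.{u}) : bd₂ G (Finsupp.single (g, h) a) =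
    Finsupp.single h a - Finsupp.single (g * h) a + Finsupp.single g a := by
  simp [bd₂, smul_add, smul_sub]

theorem bd₃_single (g h j : G) (a : QQ.{u}) : bd₃ G (Finsupp.single (g, h, j) a) =
    Finsupp.single (h, j) a - Finsupp.single (g * h, j) a + Finsupp.single (g, h * j) a -
      Finsupp.single (g, h) a := by
  simp [bd₃, smul_add, smul_sub]

/-- The trivial rational representation. -/
noncomputable abbrev trivQ : Rep QQ.{u} G := Rep.trivial QQ.{u} G QQ.{u}

theorem d₂₁_trivQ (x : G × G →₀ QQ.{u}) : groupHomology.d₂₁ (trivQ G) x = bd₂ G x := by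
  induction x using Finsupp.induction_linear with
  | zero => simp
  | add x y hx hy => rw [map_add, map_add]; exact congrArg₂ (· + ·) hx hy
  | single g a =>
    refine (groupHomology.d₂₁_single (A := trivQ G) g a).trans ?_
    rw [bd₂_single]
    rfl

theorem d₃₂_trivQ (x : G × G × G →₀ QQ.{u}) : groupHomology.d₃₂ (trivQ G) x = bd₃ G x := by
  induction x using Finsupp.induction_linear with
  | zero => simp
  | add x y hx hy => rw [map_add, map_add]; exact congrArg₂ (· + ·) hx hy
  | single g a =>
    refine (groupHomology.d₃₂_single (A := trivQ G) g a).trans ?_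
    rw [bd₃_single]
    rfl

variable {G} {H : Type u} [Group H] (f : G →* H)

/-- The map on rational `1`-chains induced by a homomorphism. -/
noncomputable def ch₁ : (G →₀ QQ.{u}) →ₗ[QQ.{u}] (H →₀ QQ.{u}) := Finsupp.lmapDomain _ _ f

/-- The map on rational `2`-chains induced by a homomorphism. -/
noncomputable def ch₂ : (G × G →₀ QQ.{u}) →ₗ[QQ.{u}] (H × H →₀ QQ.{u}) :=
  Finsupp.lmapDomain _ _ (Prod.map f f)

/-- The map on rational `3`-chains induced by a homomorphism. -/
noncomputable def ch₃ : (G × G × G →₀ QQ.{u}) →ₗ[QQ.{u}] (H × H × H →₀ QQ.{u}) :=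
  Finsupp.lmapDomain _ _ (Prod.map f (Prod.map f f))

@[simp]
theorem ch₁_single (g : G) (a : QQ.{u}) :
    ch₁ f (Finsupp.single g a) = Finsupp.single (f g) a := by
  simp [ch₁]

@[simp]
theorem ch₂_single (g h : G) (a : QQ.{u}) :
    ch₂ f (Finsupp.single (g, h) a) = Finsupp.single (f g, f h) a := by
  simp [ch₂]

@[simp]
theorem ch₃_single (g h j : G) (a : QQ.{u}) :
    ch₃ f (Finsupp.single (g, h, j) a) = Finsupp.single (f g, f h, f j) a := by
  simp [ch₃]

theorem bd₂_ch₂ (x : G × G →₀ QQ.{u}) : bd₂ H (ch₂ f x) = ch₁ f (bd₂ G x) := by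
  induction x using Finsupp.induction_linear with
  | zero => simp
  | add x y hx hy => simp only [map_add, hx, hy]
  | single g a => obtain ⟨g, h⟩ := g; simp [bd₂_single]

theorem bd₃_ch₃ (x : G × G × G →₀ QQ.{u}) : bd₃ H (ch₃ f x) = ch₂ f (bd₃ G x) := by
  induction x using Finsupp.induction_linear with
  | zero => simp
  | add x y hx hy => simp only [map_add, hx, hy]
  | single g a => obtain ⟨g, h, j⟩ := g; simp [bd₃_single]

/-- A homomorphism is rationally `2`-acyclic on the level of chains. -/
structure IsChainHQMap : Prop where
  inj₁ : ∀ x y, ch₁ f x = bd₂ H y → ∃ z, x = bd₂ G z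
  surj₁ : ∀ x, ∃ y z, x = ch₁ f y + bd₂ H z
  surj₂ : ∀ x, bd₂ H x = 0 → ∃ y z, bd₂ G y = 0 ∧ x = ch₂ f y + bd₃ H z

/-! ### Homology classes represented by explicit chains -/

open groupHomology

/-- The class of a `1`-chain in rational homology. -/
noncomputable def cls₁ (x : G →₀ QQ.{u}) : rationalHomology G 1 :=
  H1π (trivQ G) ⟨x, by rw [cycles₁_eq_top_of_isTrivial]; trivial⟩

/-- The class of a `2`-cycle in rational homology. -/
noncomputable def cls₂ (x : G × G →₀ QQ.{u}) (hx : bd₂ G x = 0) : rationalHomology G 2 :=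
  H2π (trivQ G) ⟨x, (d₂₁_trivQ G x).trans hx⟩

theorem cls₁_eq_iff (x y : G →₀ QQ.{u}) : cls₁ x = cls₁ y ↔ ∃ z, x - y = bd₂ G z := by
  refine (H1π_eq_iff _ _).trans ?_
  constructor
  · rintro ⟨z, hz⟩
    exact ⟨z, (d₂₁_trivQ G z) ▸ hz.symm⟩
  · rintro ⟨z, hz⟩
    exact ⟨z, (d₂₁_trivQ G z).trans hz.symm⟩

theorem cls₂_eq_iff (x y : G × G →₀ QQ.{u}) (hx hy) :
    cls₂ x hx = cls₂ y hy ↔ ∃ z, x - y = bd₃ G z := by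
  refine (H2π_eq_iff _ _).trans ?_
  constructor
  · rintro ⟨z, hz⟩
    exact ⟨z, (d₃₂_trivQ G z) ▸ hz.symm⟩
  · rintro ⟨z, hz⟩
    exact ⟨z, (d₃₂_trivQ G z).trans hz.symm⟩

theorem cls₁_surjective : Function.Surjective (cls₁ (G := G)) := by
  intro x
  induction x using H1_induction_on with | @h x =>
  exact ⟨x.1, rfl⟩

theorem cls₂_surjective (x : rationalHomology G 2) : ∃ y hy, cls₂ (G := G) y hy = x := by
  induction x using H2_induction_on with | @h x =>
  exact ⟨x.1, (d₂₁_trivQ G x.1).symm.trans x.2, rfl⟩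

theorem map_cls₁ (x : G →₀ QQ.{u}) : rationalHomologyMap f 1 (cls₁ x) = cls₁ (ch₁ f x) := by
  refine (H1π_comp_map_apply (A := trivQ G) (B := trivQ H) f (𝟙 _) _).trans ?_
  refine congrArg (H1π (trivQ H)) (Subtype.ext ?_)
  exact Finsupp.mapRange_id _

theorem map_cls₂ (x : G × G →₀ QQ.{u}) (hx : bd₂ G x = 0) :
    rationalHomologyMap f 2 (cls₂ x hx) =
      cls₂ (ch₂ f x) (by rw [bd₂_ch₂, hx, map_zero]) := by
  refine (H2π_comp_map_apply (A := trivQ G) (B := trivQ H) f (𝟙 _) _).trans ?_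
  refine congrArg (H2π (trivQ H)) (Subtype.ext ?_)
  exact Finsupp.mapRange_id _

theorem isHQMap_iff_chains : IsHQMap f ↔ IsChainHQMap f := by
  have hker : ∀ x : G →₀ QQ.{u}, cls₁ x = 0 ↔ ∃ z, x = bd₂ G z := by
    intro x
    have h0 : cls₁ (0 : G →₀ QQ.{u}) = 0 := map_zero (H1π (trivQ G)).hom
    rw [← h0, cls₁_eq_iff, sub_zero]
  have hker' : ∀ x : H →₀ QQ.{u}, cls₁ x = 0 ↔ ∃ z, x = bd₂ H z := by
    intro x
    have h0 : cls₁ (0 : H →₀ QQ.{u}) = 0 := map_zero (H1π (trivQ H)).hom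
    rw [← h0, cls₁_eq_iff, sub_zero]
  constructor
  · rintro ⟨⟨hi, hs⟩, hs2⟩
    refine ⟨fun x y hxy => ?_, fun x => ?_, fun x hx => ?_⟩
    · refine (hker x).1 (hi ?_)
      rw [map_cls₁, map_zero]
      exact (hker' _).2 ⟨y, hxy⟩
    · obtain ⟨a, ha⟩ := hs (cls₁ x)
      obtain ⟨y, rfl⟩ := cls₁_surjective a
      rw [map_cls₁] at ha
      obtain ⟨z, hz⟩ := (cls₁_eq_iff _ _).1 ha.symm
      exact ⟨y, z, by rw [← hz]; abel⟩
    · obtain ⟨a, ha⟩ := hs2 (cls₂ x hx)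
      obtain ⟨y, hy, rfl⟩ := cls₂_surjective a
      rw [map_cls₂] at ha
      obtain ⟨z, hz⟩ := (cls₂_eq_iff _ _ _ _).1 ha.symm
      exact ⟨y, z, hy, by rw [← hz]; abel⟩
  · intro h
    refine ⟨⟨?_, ?_⟩, ?_⟩
    · refine (injective_iff_map_eq_zero (rationalHomologyMap f 1).hom).2 fun a ha => ?_
      obtain ⟨x, rfl⟩ := cls₁_surjective a
      have ha' : rationalHomologyMap f 1 (cls₁ x) = 0 := ha
      rw [map_cls₁, hker'] at ha'
      obtain ⟨y, hy⟩ := ha'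
      exact (hker x).2 (h.inj₁ x y hy)
    · intro a
      obtain ⟨x, rfl⟩ := cls₁_surjective a
      obtain ⟨y, z, rfl⟩ := h.surj₁ x
      refine ⟨cls₁ y, ?_⟩
      rw [map_cls₁, cls₁_eq_iff]
      exact ⟨-z, by rw [map_neg]; abel⟩
    · intro a
      obtain ⟨x, hx, rfl⟩ := cls₂_surjective a
      obtain ⟨y, z, hy, rfl⟩ := h.surj₂ x hx
      refine ⟨cls₂ y hy, ?_⟩
      rw [map_cls₂, cls₂_eq_iff]
      exact ⟨-z, by rw [map_neg]; abel⟩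

end chains

/-! ### Central extensions with rational kernel -/

/-- A surjective homomorphism whose kernel is central and rational. -/
structure IsRatCentralExt {E C : Type u} [Group E] [Group C] (p : E →* C) : Prop where
  surjective : Function.Surjective p
  central : p.ker ≤ Subgroup.center E
  rational : IsRational p.ker

/-- Unique lifting of `f` against `p` in commutative squares. -/
def IsOrtho {A B E C : Type u} [Group A] [Group B] [Group E] [Group C] (f : A →* B)
    (p : E →* C) : Prop :=
  ∀ (φ : A →* E) (χ : B →* C), p.comp φ = χ.comp f →
    ∃! ψ : B →* E, ψ.comp f = φ ∧ p.comp ψ = χ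

theorem isRational_multiplicative (V : Type u) [AddCommGroup V] [Module QQ.{u} V] :
    IsRational (Multiplicative V) := by
  intro n hn
  have hn' : (n : QQ.{u}) ≠ 0 := fun h => by
    have h' : (n : ℚ) = 0 := congrArg ULift.down h
    rw [Nat.cast_eq_zero] at h'
    omega
  refine ⟨fun a b hab => ?_, fun a => ?_⟩
  · have h : n • a.toAdd = n • b.toAdd := hab
    rw [← Nat.cast_smul_eq_nsmul QQ.{u}, ← Nat.cast_smul_eq_nsmul QQ.{u}] at h
    exact smul_right_injective V hn' h
  · refine ⟨Multiplicative.ofAdd ((n : QQ.{u})⁻¹ • a.toAdd), ?_⟩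
    change n • ((n : QQ.{u})⁻¹ • a.toAdd) = a.toAdd
    rw [← Nat.cast_smul_eq_nsmul QQ.{u}, smul_inv_smul₀ hn']

/-- Unique roots exclude torsion, which gives injectivity; existing roots absorb the denominator of
every pure tensor, which gives surjectivity. -/
theorem toRat_bijective (K : Type u) [CommGroup K] (hK : IsRational K) :
    Function.Bijective (toRat K) := by
  constructor
  · refine (injective_iff_map_eq_one _).2 fun a ha => ?_
    obtain ⟨m, hm, h⟩ := (toRat_eq_one_iff a).1 ha
    exact (hK m hm).1 (h.trans (one_pow m).symm)
  · intro x
    obtain ⟨x, rfl⟩ := Multiplicative.ofAdd.surjective x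
    induction x using TensorProduct.induction_on with
    | zero => exact ⟨1, map_one _⟩
    | tmul q a =>
      obtain ⟨b, hb⟩ := (hK q.den q.pos).2 a.toMul
      refine ⟨b ^ q.num, congrArg Multiplicative.ofAdd ?_⟩
      have hb' : a = (q.den : ℤ) • Additive.ofMul b := by
        rw [natCast_zsmul]; exact hb.symm
      change (1 : ℚ) ⊗ₜ[ℤ] (q.num • Additive.ofMul b) = _
      rw [hb', ← TensorProduct.smul_tmul, ← TensorProduct.smul_tmul]
      congr 1
      rw [zsmul_eq_mul, zsmul_eq_mul, mul_one, Int.cast_natCast, mul_comm, Rat.mul_den_eq_num]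
    | add x y hx hy =>
      obtain ⟨a, ha⟩ := hx
      obtain ⟨b, hb⟩ := hy
      exact ⟨a * b, by rw [map_mul, ha, hb]; rfl⟩

/-- The kernel of a rational central extension is a rational vector space. -/
theorem IsRatCentralExt.exists_module {E C : Type u} [Group E] [Group C] {p : E →* C}
    (hp : IsRatCentralExt p) : ∃ (W : Type u) (_ : AddCommGroup W) (_ : Module QQ.{u} W)
      (ι : Multiplicative W →* E), Function.Injective ι ∧ ι.range = p.ker := by
  let : CommGroup p.ker :=
    { mul_comm := fun a b => Subtype.ext (Subgroup.mem_center_iff.1 (hp.central b.2) a) }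
  let e := MulEquiv.ofBijective (toRat p.ker) (toRat_bijective p.ker hp.rational)
  refine ⟨ℚ ⊗[ℤ] Additive p.ker, inferInstance, inferInstance,
    p.ker.subtype.comp e.symm.toMonoidHom, p.ker.subtype_injective.comp e.symm.injective, ?_⟩
  rw [MonoidHom.range_comp, MonoidHom.range_eq_top.2 e.symm.surjective, ← MonoidHom.range_eq_map,
    Subgroup.range_subtype]

/-- The map `c` descends to the range of `d`, and over a field it extends from a subspace. This
replaces any appeal to universal coefficients. -/
theorem exists_linear_factor {k U W V : Type*} [Field k] [AddCommGroup U] [AddCommGroup W]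
    [AddCommGroup V] [Module k U] [Module k W] [Module k V] (d : U →ₗ[k] W) (c : U →ₗ[k] V)
    (h : ∀ x, d x = 0 → c x = 0) : ∃ t : W →ₗ[k] V, ∀ x, t (d x) = c x := by
  obtain ⟨t, ht⟩ := LinearMap.exists_extend
    (((LinearMap.ker d).liftQ c h).comp d.quotKerEquivRange.symm.toLinearMap)
  refine ⟨t, fun x => ?_⟩
  have := LinearMap.congr_fun ht ⟨d x, x, rfl⟩
  refine this.trans ?_
  have h2 : d.quotKerEquivRange.symm ⟨d x, x, rfl⟩ = Submodule.Quotient.mk x :=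
    d.quotKerEquivRange_symm_apply_image x _
  change (LinearMap.ker d).liftQ c h (d.quotKerEquivRange.symm ⟨d x, x, rfl⟩) = _
  rw [h2]
  rfl

/-- The linear extension of a function on a group to `1`-chains. -/
noncomputable abbrev lin₁ {G V : Type u} [AddCommGroup V] [Module QQ.{u} V] (φ : G → V) :
    (G →₀ QQ.{u}) →ₗ[QQ.{u}] V := Finsupp.linearCombination _ φ

/-- The linear extension of a function of two variables to `2`-chains. -/
noncomputable abbrev lin₂ {G V : Type u} [AddCommGroup V] [Module QQ.{u} V] (c : G → G → V) :
    (G × G →₀ QQ.{u}) →ₗ[QQ.{u}] V := Finsupp.linearCombination _ fun g => c g.1 g.2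

theorem lin₂_bd₃ {G V : Type u} [Group G] [AddCommGroup V] [Module QQ.{u} V] (c : G → G → V)
    (hc : ∀ x y z, c x y + c (x * y) z = c y z + c x (y * z)) (z : G × G × G →₀ QQ.{u}) :
    lin₂ c (bd₃ G z) = 0 := by
  induction z using Finsupp.induction_linear with
  | zero => simp
  | add x y hx hy => rw [map_add, map_add, hx, hy, add_zero]
  | single g a =>
    obtain ⟨x, y, z⟩ := g
    simp only [bd₃_single, map_add, map_sub, Finsupp.linearCombination_single]
    rw [← smul_sub, ← smul_add, ← smul_sub]
    rw [show c y z - c (x * y) z + c x (y * z) - c x y = 0 by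
      rw [sub_add_eq_add_sub, ← hc, sub_sub, add_comm (c x y), sub_self], smul_zero]

theorem linear_ext₂ {G V : Type u} [AddCommGroup V] [Module QQ.{u} V]
    {a b : (G × G →₀ QQ.{u}) →ₗ[QQ.{u}] V}
    (h : ∀ x y, a (Finsupp.single (x, y) 1) = b (Finsupp.single (x, y) 1))
    (z : G × G →₀ QQ.{u}) : a z = b z := by
  refine LinearMap.congr_fun (Finsupp.lhom_ext' fun g => LinearMap.ext_ring ?_) z
  exact h g.1 g.2

theorem linear_ext₁ {G V : Type u} [AddCommGroup V] [Module QQ.{u} V]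
    {a b : (G →₀ QQ.{u}) →ₗ[QQ.{u}] V}
    (h : ∀ x, a (Finsupp.single x 1) = b (Finsupp.single x 1))
    (z : G →₀ QQ.{u}) : a z = b z := by
  refine LinearMap.congr_fun (Finsupp.lhom_ext' fun g => LinearMap.ext_ring ?_) z
  exact h g

section forward

variable {A B E C : Type u} [Group A] [Group B] [Group E] [Group C] {f : A →* B} {p : E →* C}

/-- A set-theoretic section over `B` gives a 2-cocycle `c`, and `φ` trivialises its pullback to `A`
by a cochain `e`. A lift is a trivialisation `r` of `c` that restricts to `e`; `inj₁` and `surj₂`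
make it exist, and `surj₁` makes it unique. -/
theorem IsChainHQMap.isOrtho (hf : IsChainHQMap f) (hp : IsRatCentralExt p) :
    IsOrtho f p := by
  intro φ χ hsq
  obtain ⟨W, _, _, ι, hι, hr⟩ := hp.exists_module
  have hιp : ∀ w, p (ι w) = 1 := fun w => by
    have : ι w ∈ p.ker := hr ▸ ⟨w, rfl⟩
    exact this
  have hιc : ∀ w x, x * ι w = ι w * x := fun w x =>
    Subgroup.mem_center_iff.1 (hp.central (hιp w)) x
  have hdiv : ∀ x y, p x = p y → ∃ w : W, x = ι (Multiplicative.ofAdd w) * y := fun x y hxy => by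
    have : x * y⁻¹ ∈ ι.range := by
      rw [hr, MonoidHom.mem_ker, map_mul, map_inv, hxy, mul_inv_cancel]
    obtain ⟨w, hw⟩ := this
    exact ⟨w.toAdd, by rw [ofAdd_toAdd, hw, inv_mul_cancel_right]⟩
  have hsq' : ∀ a, p (φ a) = χ (f a) := fun a => DFunLike.congr_fun hsq a
  have hadd : ∀ (w w' : W) (x y : E), ι (Multiplicative.ofAdd w) * x *
      (ι (Multiplicative.ofAdd w') * y) = ι (Multiplicative.ofAdd (w + w')) * (x * y) := by
    intro w w' x y
    rw [ofAdd_add, map_mul, mul_assoc, ← mul_assoc x, hιc _ x, mul_assoc, mul_assoc]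
  have hinj : ∀ (w w' : W) (x : E), ι (Multiplicative.ofAdd w) * x =
      ι (Multiplicative.ofAdd w') * x → w = w' := fun w w' x h =>
    Multiplicative.ofAdd.injective (hι (mul_right_cancel h))
  have hexists : ∃ ψ : B →* E, ψ.comp f = φ ∧ p.comp ψ = χ := by
    choose s hs using fun b => hp.surjective (χ b)
    have hc : ∀ b b', ∃ w : W, s b * s b' = ι (Multiplicative.ofAdd w) * s (b * b') :=
      fun b b' => hdiv _ _ (by rw [map_mul, hs, hs, hs, map_mul])
    choose c hc using hc
    have hcoc : ∀ x y z, c x y + c (x * y) z = c y z + c x (y * z) := by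
      intro x y z
      apply hinj _ _ (s (x * y * z))
      have h1 : s x * s y * s z =
          ι (Multiplicative.ofAdd (c x y + c (x * y) z)) * s (x * y * z) := by
        rw [hc, mul_assoc, hc, ofAdd_add, map_mul, mul_assoc (ι _)]
      have h2 : s x * (s y * s z) =
          ι (Multiplicative.ofAdd (c y z + c x (y * z))) * s (x * y * z) := by
        rw [hc, ← mul_assoc, hιc, mul_assoc, hc, ofAdd_add, map_mul, mul_assoc, mul_assoc x]
      rw [← h1, ← h2, mul_assoc]
    choose e he using fun a => hdiv (φ a) (s (f a)) (by rw [hs, hsq'])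
    have hce : ∀ a a', e (a * a') = e a + e a' + c (f a) (f a') := by
      intro a a'
      apply hinj _ _ (s (f (a * a')))
      rw [← he, map_mul, he a, he a', hadd, map_mul, hc, ofAdd_add (e a + e a'), map_mul ι,
        mul_assoc]
    have hce' : ∀ y, lin₂ c (ch₂ f y) = -lin₁ e (bd₂ A y) := by
      intro y
      have := linear_ext₂ (a := lin₂ c ∘ₗ ch₂ f) (b := -(lin₁ e ∘ₗ bd₂ A)) (fun a a' => by
        simp only [LinearMap.comp_apply, ch₂_single, LinearMap.neg_apply, bd₂_single, map_add,
          map_sub, Finsupp.linearCombination_single, one_smul, hce]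
        abel) y
      exact this
    -- Modulo boundaries every 2-cycle of `B` comes from a 2-cycle of `A`, where `c` is a
    -- coboundary.
    have hZ : ∀ x, bd₂ B x = 0 → lin₂ c x = 0 := by
      intro x hx
      obtain ⟨y, z, hy, rfl⟩ := hf.surj₂ x hx
      rw [map_add, lin₂_bd₃ c hcoc, hce', hy, map_zero, neg_zero, add_zero]
    -- The requirements on `r` are `r (f y) = e y` and `r (∂ z) = -c z`. They are consistent: if `f
    -- y + ∂ z = 0`, then `y = ∂ z'` by `inj₁`, and `c` vanishes on the cycle `f z' + z`.
    obtain ⟨r, hrr⟩ := exists_linear_factor ((ch₁ f).coprod (bd₂ B))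
      ((lin₁ e).coprod (-lin₂ c)) (by
        rintro ⟨y, z⟩ hyz
        rw [LinearMap.coprod_apply] at hyz ⊢
        obtain ⟨z', rfl⟩ := hf.inj₁ y (-z) (by rw [map_neg]; exact eq_neg_of_add_eq_zero_left hyz)
        have h1 := hZ (ch₂ f z' + z) (by rw [map_add, bd₂_ch₂]; exact hyz)
        rw [map_add, hce'] at h1
        rw [LinearMap.neg_apply]
        rw [← neg_eq_zero, neg_add, neg_neg]
        exact h1)
    have hr1 : ∀ a, r (Finsupp.single (f a) 1) = e a := fun a => by
      have := hrr (Finsupp.single a 1, 0)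
      simpa using this
    have hr2 : ∀ b b', r (Finsupp.single (b * b') 1) =
        r (Finsupp.single b 1) + r (Finsupp.single b' 1) + c b b' := fun b b' => by
      have := hrr (0, Finsupp.single (b, b') 1)
      simp only [LinearMap.coprod_apply, map_zero, zero_add, bd₂_single, map_add, map_sub,
        LinearMap.neg_apply, Finsupp.linearCombination_single, one_smul] at this
      rw [← neg_eq_iff_eq_neg.2 this]
      abel
    refine ⟨MonoidHom.mk' (fun b => ι (Multiplicative.ofAdd (r (Finsupp.single b 1))) * s b)
      fun b b' => ?_, ?_, ?_⟩
    · rw [hadd, hc, hr2, ofAdd_add _ (c b b'), map_mul ι, mul_assoc]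
    · ext a
      change ι (Multiplicative.ofAdd (r (Finsupp.single (f a) 1))) * s (f a) = φ a
      rw [hr1, ← he]
    · ext b
      change p (ι (Multiplicative.ofAdd (r (Finsupp.single b 1))) * s b) = χ b
      rw [map_mul, hιp, one_mul, hs]
  obtain ⟨ψ, hψ⟩ := hexists
  refine ⟨ψ, hψ, fun ψ' hψ' => ?_⟩
  -- Two lifts differ by a homomorphism `δ` from `B` to the kernel that is trivial on the image of
  -- `A`. It kills boundaries and pushed-forward chains, hence every 1-chain by `surj₁`.
  choose δ hδ using fun b => hdiv (ψ' b) (ψ b)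
    ((DFunLike.congr_fun hψ'.2 b).trans (DFunLike.congr_fun hψ.2 b).symm)
  have hδm : ∀ b b', δ (b * b') = δ b + δ b' := fun b b' => by
    apply hinj _ _ (ψ (b * b'))
    rw [← hδ, map_mul, hδ b, hδ b', hadd, map_mul]
  have h1 : ∀ z, lin₁ δ (bd₂ B z) = 0 := fun z =>
    linear_ext₂ (a := lin₁ δ ∘ₗ bd₂ B) (b := 0) (fun x y => by
      simp only [LinearMap.comp_apply, bd₂_single, map_add, map_sub,
        Finsupp.linearCombination_single, one_smul, hδm, LinearMap.zero_apply]
      abel) z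
  have h2 : ∀ y, lin₁ δ (ch₁ f y) = 0 := fun y =>
    linear_ext₁ (a := lin₁ δ ∘ₗ ch₁ f) (b := 0) (fun a => by
      simp only [LinearMap.comp_apply, ch₁_single, Finsupp.linearCombination_single, one_smul,
        LinearMap.zero_apply]
      apply hinj _ _ (ψ (f a))
      rw [← hδ, ofAdd_zero, map_one, one_mul]
      exact (DFunLike.congr_fun hψ'.1 a).trans (DFunLike.congr_fun hψ.1 a).symm) y
  ext b
  have h3 : lin₁ δ (Finsupp.single b 1) = 0 := by
    obtain ⟨y, z, hyz⟩ := hf.surj₁ (Finsupp.single b 1)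
    rw [hyz, map_add, h1, h2, add_zero]
  rw [Finsupp.linearCombination_single, one_smul] at h3
  rw [hδ, h3, ofAdd_zero, map_one, one_mul]

end forward

/-! ### Extensions defined by cocycles -/

/-- The underlying set of the central extension of `B` by `V` defined by a cocycle `c`. -/
@[ext]
structure CocycleExt {B V : Type u} [Group B] [AddCommGroup V] (c : B → B → V) : Type u where
  fst : V
  snd : B

namespace CocycleExt

variable {B V : Type u} [Group B] [AddCommGroup V] {c : B → B → V}

/-- The group structure of the central extension defined by a cocycle. -/
@[reducible]
def group (hc : ∀ x y z, c x y + c (x * y) z = c y z + c x (y * z)) : Group (CocycleExt c) where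
  mul a b := ⟨a.fst + b.fst + c a.snd b.snd, a.snd * b.snd⟩
  one := ⟨-c 1 1, 1⟩
  inv a := ⟨-a.fst - c a.snd⁻¹ a.snd - c 1 1, a.snd⁻¹⟩
  mul_assoc x y z := by
    refine CocycleExt.ext ?_ (mul_assoc _ _ _)
    change x.fst + y.fst + c x.snd y.snd + z.fst + c (x.snd * y.snd) z.snd =
      x.fst + (y.fst + z.fst + c y.snd z.snd) + c x.snd (y.snd * z.snd)
    have := hc x.snd y.snd z.snd
    rw [show x.fst + y.fst + c x.snd y.snd + z.fst + c (x.snd * y.snd) z.snd =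
      x.fst + y.fst + z.fst + (c x.snd y.snd + c (x.snd * y.snd) z.snd) by abel, this]
    abel
  one_mul x := by
    refine CocycleExt.ext ?_ (one_mul _)
    change -c 1 1 + x.fst + c 1 x.snd = x.fst
    have := hc 1 1 x.snd
    rw [one_mul, one_mul] at this
    rw [add_right_cancel this]
    abel
  mul_one x := by
    refine CocycleExt.ext ?_ (mul_one _)
    change x.fst + -c 1 1 + c x.snd 1 = x.fst
    have := hc x.snd 1 1
    rw [mul_one, mul_one] at this
    rw [add_right_cancel this]
    abel
  inv_mul_cancel x := by
    refine CocycleExt.ext ?_ (inv_mul_cancel _)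
    change -x.fst - c x.snd⁻¹ x.snd - c 1 1 + x.fst + c x.snd⁻¹ x.snd = -c 1 1
    abel

end CocycleExt

section backward

variable {A B : Type u} [Group A] [Group B] {f : A →* B}

theorem isRatCentralExt_toPUnit (V : Type u) [AddCommGroup V] [Module QQ.{u} V] :
    IsRatCentralExt (1 : Multiplicative V →* PUnit.{u + 1}) := by
  refine ⟨fun x => ⟨1, rfl⟩, fun x _ => Subgroup.mem_center_iff.2 fun y => mul_comm y x, ?_⟩
  intro n hn
  refine ⟨fun a b hab => Subtype.ext
    ((isRational_multiplicative V n hn).1 (congrArg Subtype.val hab)), fun a => ?_⟩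
  obtain ⟨b, hb⟩ := (isRational_multiplicative V n hn).2 a.1
  exact ⟨⟨b, rfl⟩, Subtype.ext hb⟩

/-- Each chain condition is detected by a universal coefficient space: extensions of the trivial
group handle `H₁`, and the extension of `B` by a tautological cocycle handles `H₂`. -/
theorem isChainHQMap_of_isOrtho
    (hf : ∀ (E C : Type u) [Group E] [Group C] (p : E →* C), IsRatCentralExt p → IsOrtho f p) :
    IsChainHQMap f := by
  have hom : ∀ (V : Type u) [AddCommGroup V] [Module QQ.{u} V] (φ : A →* Multiplicative V),
      ∃! ψ : B →* Multiplicative V, ψ.comp f = φ := by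
    intro V _ _ φ
    obtain ⟨ψ, hψ, hu⟩ := hf _ _ _ (isRatCentralExt_toPUnit V) φ 1 rfl
    exact ⟨ψ, hψ.1, fun ψ' hψ' => hu ψ' ⟨hψ', rfl⟩⟩
  have mkhom : ∀ {G V : Type u} [Group G] [AddCommGroup V] [Module QQ.{u} V]
      (t : (G →₀ QQ.{u}) →ₗ[QQ.{u}] V), (∀ z, t (bd₂ G z) = 0) →
      ∃ φ : G →* Multiplicative V, ∀ g, (φ g).toAdd = t (Finsupp.single g 1) := by
    intro G V _ _ _ t ht
    refine ⟨MonoidHom.mk' (fun g => Multiplicative.ofAdd (t (Finsupp.single g 1)))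
      fun g h => ?_, fun g => rfl⟩
    rw [← ofAdd_add]
    have := ht (Finsupp.single (g, h) 1)
    rw [bd₂_single, map_add, map_sub, sub_add_eq_add_sub, sub_eq_zero] at this
    rw [← this, add_comm]
  refine ⟨?_, ?_, ?_⟩
  -- The tautological homomorphism from `A` to 1-chains modulo boundaries extends to `B`, and the
  -- extension kills `bd₂ B y`.
  · intro x y hxy
    obtain ⟨φ, hφ⟩ := mkhom (LinearMap.range (bd₂ A)).mkQ
      (fun z => (Submodule.Quotient.mk_eq_zero _).2 ⟨z, rfl⟩)
    obtain ⟨ψ, hψ, -⟩ := hom _ φ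
    have h1 : ∀ x, lin₁ (fun b => (ψ b).toAdd) (ch₁ f x) = (LinearMap.range (bd₂ A)).mkQ x :=
      fun x => linear_ext₁ (a := lin₁ (fun b => (ψ b).toAdd) ∘ₗ ch₁ f) (fun a => by
        rw [LinearMap.comp_apply, ch₁_single, Finsupp.linearCombination_single, one_smul, ← hφ,
          ← hψ]
        rfl) x
    have h2 : lin₁ (fun b => (ψ b).toAdd) (bd₂ B y) = 0 :=
      linear_ext₂ (a := lin₁ (fun b => (ψ b).toAdd) ∘ₗ bd₂ B) (b := 0) (fun b b' => by
        simp only [LinearMap.comp_apply, bd₂_single, map_add, map_sub,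
          Finsupp.linearCombination_single, one_smul, map_mul, toAdd_mul, LinearMap.zero_apply]
        abel) y
    rw [← hxy, h1] at h2
    obtain ⟨z, hz⟩ := (Submodule.Quotient.mk_eq_zero _).1 h2
    exact ⟨z, hz.symm⟩
  -- The tautological homomorphism from `B` to the cokernel is trivial on `A`, so by uniqueness it
  -- is trivial.
  · intro x
    let S := LinearMap.range ((ch₁ f).coprod (bd₂ B))
    obtain ⟨φ, hφ⟩ := mkhom S.mkQ
      (fun z => (Submodule.Quotient.mk_eq_zero _).2 ⟨(0, z), by simp⟩)
    have hφ1 : φ = 1 := by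
      obtain ⟨ψ, -, hu⟩ := hom (( B →₀ QQ.{u}) ⧸ S) 1
      refine (hu φ ?_).trans (hu 1 rfl).symm
      ext a
      apply Multiplicative.toAdd.injective
      exact (hφ (f a)).trans
        ((Submodule.Quotient.mk_eq_zero _).2 ⟨(Finsupp.single a 1, 0), by simp⟩)
    have h0 : S.mkQ x = 0 := linear_ext₁ (a := S.mkQ) (b := 0) (fun b => by
      rw [← hφ, hφ1]; rfl) x
    obtain ⟨⟨y, z⟩, hyz⟩ := (Submodule.Quotient.mk_eq_zero _).1 h0
    exact ⟨y, z, hyz.symm⟩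
  -- The coefficients are the 2-chains of `B` modulo boundaries and images of 2-cycles of `A`. The
  -- tautological cocycle `c` becomes a coboundary over `A`, since it vanishes there on cycles.
  · intro x hx
    let S := LinearMap.range (((ch₂ f).comp (LinearMap.ker (bd₂ A)).subtype).coprod (bd₃ B))
    let c : B → B → (B × B →₀ QQ.{u}) ⧸ S := fun b b' => S.mkQ (Finsupp.single (b, b') 1)
    have hlin : ∀ z, lin₂ c z = S.mkQ z := fun z =>
      linear_ext₂ (a := lin₂ c) (b := S.mkQ) (fun b b' => by
        rw [Finsupp.linearCombination_single, one_smul]) z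
    have hc : ∀ x y z, c x y + c (x * y) z = c y z + c x (y * z) := by
      intro x y z
      rw [← sub_eq_zero]
      have : S.mkQ (bd₃ B (Finsupp.single (x, y, z) 1)) = 0 :=
        (Submodule.Quotient.mk_eq_zero _).2 ⟨(0, Finsupp.single (x, y, z) 1), by simp⟩
      rw [bd₃_single, map_sub, map_add, map_sub] at this
      rw [← neg_eq_zero, ← this]
      change _ = c y z - c (x * y) z + c x (y * z) - c x y
      abel
    obtain ⟨e, he⟩ := exists_linear_factor (bd₂ A) (lin₂ c ∘ₗ ch₂ f) (fun y hy => by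
      rw [LinearMap.comp_apply, hlin]
      exact (Submodule.Quotient.mk_eq_zero _).2 ⟨(⟨y, hy⟩, 0), by simp⟩)
    let := CocycleExt.group hc
    let p : CocycleExt c →* B := MonoidHom.mk' CocycleExt.snd fun _ _ => rfl
    have hmul : ∀ a b : CocycleExt c, a * b = ⟨a.fst + b.fst + c a.snd b.snd, a.snd * b.snd⟩ :=
      fun _ _ => rfl
    have hc1 : ∀ b, c 1 b = c 1 1 := fun b => by
      have := hc 1 1 b
      rw [one_mul, one_mul] at this
      exact (add_right_cancel this).symm
    have hc2 : ∀ b, c b 1 = c 1 1 := fun b => by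
      have := hc b 1 1
      rw [mul_one, mul_one] at this
      exact add_right_cancel this
    -- The neutral element is `(-c 1 1, 1)`, as `c` is not normalised. The shift by `c 1 1`
    -- identifies the kernel with the vector space.
    have hpow : ∀ (v : (B × B →₀ QQ.{u}) ⧸ S) (n : ℕ),
        (⟨v - c 1 1, 1⟩ : CocycleExt c) ^ n = ⟨n • v - c 1 1, 1⟩ := by
      intro v n
      induction n with
      | zero => rw [zero_smul, zero_sub]; rfl
      | succ n ih =>
        rw [pow_succ, ih, hmul]
        refine CocycleExt.ext ?_ (one_mul _)
        change n • v - c 1 1 + (v - c 1 1) + c 1 1 = _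
        rw [succ_nsmul, add_assoc, sub_add_cancel, sub_add_eq_add_sub]
    have hker : ∀ a : p.ker, a.1 = ⟨(a.1.fst + c 1 1) - c 1 1, 1⟩ := fun a =>
      CocycleExt.ext (by rw [add_sub_cancel_right]) a.2
    have hrat := isRational_multiplicative ((B × B →₀ QQ.{u}) ⧸ S)
    have hp : IsRatCentralExt p := by
      refine ⟨fun b => ⟨⟨0, b⟩, rfl⟩, fun a ha => Subgroup.mem_center_iff.2 fun b => ?_,
        fun n hn => ⟨fun a b hab => ?_, fun a => ?_⟩⟩
      · have ha' : a.snd = 1 := ha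
        rw [hmul, hmul, ha', hc1, hc2, mul_one, one_mul, add_comm a.fst]
      · have h1 := congrArg Subtype.val hab
        change a.1 ^ n = b.1 ^ n at h1
        rw [hker a, hker b, hpow, hpow] at h1
        have h2 : n • (a.1.fst + c 1 1) = n • (b.1.fst + c 1 1) :=
          sub_left_injective (congrArg CocycleExt.fst h1)
        have h3 : a.1.fst + c 1 1 = b.1.fst + c 1 1 := (hrat n hn).1 h2
        refine Subtype.ext ?_
        rw [hker a, hker b, h3]
      · obtain ⟨v, hv⟩ := (hrat n hn).2 (Multiplicative.ofAdd (a.1.fst + c 1 1))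
        refine ⟨⟨⟨v.toAdd - c 1 1, 1⟩, rfl⟩, Subtype.ext ?_⟩
        refine (hpow v.toAdd n).trans ?_
        rw [hker a]
        congr 2
    let φ : A →* CocycleExt c := MonoidHom.mk' (fun a => ⟨-e (Finsupp.single a 1), f a⟩) (by
      intro a a'
      refine CocycleExt.ext ?_ (map_mul f a a')
      change -e (Finsupp.single (a * a') 1) = -e (Finsupp.single a 1) + -e (Finsupp.single a' 1) +
        c (f a) (f a')
      have := he (Finsupp.single (a, a') 1)
      rw [LinearMap.comp_apply, ch₂_single, Finsupp.linearCombination_single, one_smul,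
        bd₂_single, map_add, map_sub] at this
      rw [← this]
      abel)
    -- Lifting the identity of `B` splits the extension, so `c` is a coboundary and vanishes on the
    -- cycle `x`.
    obtain ⟨ψ, ⟨-, hψ⟩, -⟩ := hf _ _ p hp φ (MonoidHom.id B) rfl
    have hψ2 : ∀ b, (ψ b).snd = b := fun b => DFunLike.congr_fun hψ b
    have h1 : lin₂ c x = -lin₁ (fun b => (ψ b).fst) (bd₂ B x) :=
      linear_ext₂ (a := lin₂ c) (b := -(lin₁ (fun b => (ψ b).fst) ∘ₗ bd₂ B)) (fun b b' => by
        have := congrArg CocycleExt.fst (map_mul ψ b b')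
        rw [hmul, hψ2, hψ2] at this
        simp only [LinearMap.neg_apply, LinearMap.comp_apply, bd₂_single, map_add, map_sub,
          Finsupp.linearCombination_single, one_smul, this]
        abel) x
    rw [hx, map_zero, neg_zero, hlin] at h1
    obtain ⟨⟨y, z⟩, hyz⟩ := (Submodule.Quotient.mk_eq_zero _).1 h1
    exact ⟨y.1, z, y.2, hyz.symm⟩

theorem isHQMap_iff_isOrtho : IsHQMap f ↔
    ∀ (E C : Type u) [Group E] [Group C] (p : E →* C), IsRatCentralExt p → IsOrtho f p := by
  rw [isHQMap_iff_chains]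
  exact ⟨fun h _ _ _ _ _ hp => h.isOrtho hp, isChainHQMap_of_isOrtho⟩

end backward

/-! ### Local groups are rational -/

theorem IsRational.pow_injective {G : Type u} [Group G] (hG : IsRational G) {n : ℕ} (hn : 1 ≤ n)
    {a b : G} (h : a ^ n = b ^ n) : a = b := (hG n hn).1 h

theorem IsRational.exists_pow_eq {G : Type u} [Group G] (hG : IsRational G) {n : ℕ} (hn : 1 ≤ n)
    (a : G) : ∃ b : G, b ^ n = a := (hG n hn).2 a

/-- The infinite cyclic group in the universe `u`. -/
abbrev IntGrp : Type u := Multiplicative (ULift.{u} ℤ)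

/-- The homomorphism from the infinite cyclic group determined by an element. -/
def intHom {G : Type u} [Group G] (g : G) : IntGrp.{u} →* G :=
  (zpowersHom G g).comp (AddMonoidHom.toMultiplicative AddEquiv.ulift.toAddMonoidHom)

/-- The generator of the infinite cyclic group. -/
def intGen : IntGrp.{u} := Multiplicative.ofAdd ⟨1⟩

theorem intHom_gen {G : Type u} [Group G] (g : G) : intHom g intGen.{u} = g := zpow_one g

theorem intHom_ext {G : Type u} [Group G] {φ ψ : IntGrp.{u} →* G}
    (h : φ intGen = ψ intGen) : φ = ψ := by
  have key : ∀ χ : IntGrp.{u} →* G, ∀ x : IntGrp.{u}, χ x = χ intGen ^ x.toAdd.down := by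
    intro χ x
    rw [← map_zpow]
    congr 1
    apply Multiplicative.toAdd.injective
    apply ULift.down_injective
    change _ = (x.toAdd.down • (⟨1⟩ : ULift.{u} ℤ)).down
    simp
  refine MonoidHom.ext fun x => ?_
  rw [key φ, key ψ, h]

/-- Lifting against a central extension means extracting an `n`-th root of an element whose image
already has a chosen root. Any lift `y` of that root fails by a central factor, which has a unique
`n`-th root `v` in the kernel; `v * y` is the only solution. -/
theorem isHQMap_intHom_pow {n : ℕ} (hn : 1 ≤ n) : IsHQMap (intHom (intGen.{u} ^ n)) := by
  rw [isHQMap_iff_isOrtho]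
  intro E C _ _ p hp φ χ hsq
  obtain ⟨y, hy⟩ := hp.surjective (χ intGen)
  have h1 : p (φ intGen) = p y ^ n := by
    have := DFunLike.congr_fun hsq intGen
    rw [MonoidHom.comp_apply, MonoidHom.comp_apply, intHom_gen, map_pow] at this
    rw [this, hy]
  have h2 : φ intGen * (y ^ n)⁻¹ ∈ p.ker := by
    rw [MonoidHom.mem_ker, map_mul, h1, map_inv, map_pow, mul_inv_cancel]
  obtain ⟨v, hv⟩ := hp.rational.exists_pow_eq hn ⟨_, h2⟩
  have hv' : v.1 ^ n = φ intGen * (y ^ n)⁻¹ := congrArg Subtype.val hv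
  have hpow : (v.1 * y) ^ n = φ intGen := by
    rw [(show Commute v.1 y from (Subgroup.mem_center_iff.1 (hp.central v.2) y).symm).mul_pow, hv',
      inv_mul_cancel_right]
  refine ⟨intHom (v.1 * y), ⟨intHom_ext ?_, intHom_ext ?_⟩, fun ψ hψ => intHom_ext ?_⟩
  · rw [MonoidHom.comp_apply, intHom_gen, map_pow, intHom_gen, hpow]
  · rw [MonoidHom.comp_apply, intHom_gen, map_mul, v.2, one_mul, hy]
  · rw [intHom_gen]
    have h3 : ψ intGen * y⁻¹ ∈ p.ker := by
      rw [MonoidHom.mem_ker, map_mul, map_inv, hy, ← DFunLike.congr_fun hψ.2 intGen]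
      exact mul_inv_cancel _
    have h4 : (⟨_, h3⟩ : p.ker) = v := by
      refine hp.rational.pow_injective hn (Subtype.ext ?_)
      change (ψ intGen * y⁻¹) ^ n = v.1 ^ n
      have hc : Commute (ψ intGen * y⁻¹) y :=
        (Subgroup.mem_center_iff.1 (hp.central h3) y).symm
      have h5 : (ψ intGen * y⁻¹ * y) ^ n = φ intGen := by
        rw [inv_mul_cancel_right, ← map_pow, ← DFunLike.congr_fun hψ.1 intGen,
          MonoidHom.comp_apply, intHom_gen]
      rw [hc.mul_pow] at h5
      rw [hv', ← h5, mul_inv_cancel_right]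
    rw [← congrArg Subtype.val h4, inv_mul_cancel_right]

/-- Homomorphisms from the infinite cyclic group are elements, and precomposition with
multiplication by `n` is the `n`-th power map. -/
theorem IsHQLocal.isRational {L : Type u} [Group L] (hL : IsHQLocal L) : IsRational L := by
  intro n hn
  have h := hL _ _ _ (isHQMap_intHom_pow.{u} hn)
  constructor
  · intro a b hab
    have : intHom a = intHom b := h.1 (intHom_ext (by
      simp only [MonoidHom.comp_apply, intHom_gen, map_pow]
      exact hab))
    rw [← intHom_gen a, this, intHom_gen]
  · intro a
    obtain ⟨ψ, hψ⟩ := h.2 (intHom a)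
    refine ⟨ψ intGen, ?_⟩
    have := DFunLike.congr_fun hψ intGen
    simpa only [MonoidHom.comp_apply, intHom_gen, map_pow] using this

/-! ### Central quotients of rational groups -/

/-- Conjugates of `z` have the same `n`-th power as `z`, and roots are unique. -/
theorem IsRational.mem_center_of_pow {R : Type u} [Group R] (hR : IsRational R) {n : ℕ}
    (hn : 1 ≤ n) {z : R} (hz : z ^ n ∈ Subgroup.center R) : z ∈ Subgroup.center R := by
  rw [Subgroup.mem_center_iff] at hz ⊢
  intro g
  have h2 : (g * z * g⁻¹) ^ n = z ^ n := by
    rw [conj_pow, hz g, mul_inv_cancel_right]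
  exact mul_inv_eq_iff_eq_mul.1 (hR.pow_injective hn h2)

theorem IsRational.center {R : Type u} [Group R] (hR : IsRational R) :
    IsRational (Subgroup.center R) := by
  intro n hn
  refine ⟨fun a b hab => Subtype.ext (hR.pow_injective hn (congrArg Subtype.val hab)),
    fun a => ?_⟩
  obtain ⟨b, hb⟩ := hR.exists_pow_eq hn a.1
  exact ⟨⟨b, hR.mem_center_of_pow hn (hb ▸ a.2)⟩, Subtype.ext hb⟩

theorem IsRational.quotient_center {R : Type u} [Group R] (hR : IsRational R) :
    IsRational (R ⧸ Subgroup.center R) := by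
  intro n hn
  constructor
  · intro x y
    induction x using QuotientGroup.induction_on with | H x => ?_
    induction y using QuotientGroup.induction_on with | H y => ?_
    intro hxy
    have h1 : (x ^ n)⁻¹ * y ^ n ∈ Subgroup.center R := by
      rw [← QuotientGroup.eq]; exact hxy
    obtain ⟨z, hz⟩ := hR.exists_pow_eq hn ((x ^ n)⁻¹ * y ^ n)
    have hzc : z ∈ Subgroup.center R := hR.mem_center_of_pow hn (hz ▸ h1)
    have hcomm : Commute x z := Subgroup.mem_center_iff.1 hzc x
    have h4 : x * z = y := by
      apply hR.pow_injective hn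
      rw [hcomm.mul_pow, hz, mul_inv_cancel_left]
    rw [QuotientGroup.eq, ← h4, inv_mul_cancel_left]
    exact hzc
  · intro x
    induction x using QuotientGroup.induction_on with | H x => ?_
    obtain ⟨y, hy⟩ := hR.exists_pow_eq hn x
    exact ⟨(y : R ⧸ Subgroup.center R), congrArg _ hy⟩

theorem lowerCentralSeries_le_center {R : Type u} [Group R] {c : ℕ}
    (h : (⊤ : Subgroup R).lowerCentralSeries (c + 1) = ⊥) :
    (⊤ : Subgroup R).lowerCentralSeries c ≤ Subgroup.center R := by
  intro s hs
  rw [Subgroup.mem_center_iff]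
  intro g
  have h1 : ⁅s, g⁆ ∈ (⊤ : Subgroup R).lowerCentralSeries (c + 1) :=
    Subgroup.commutator_mem_commutator hs trivial
  rw [h, Subgroup.mem_bot, commutatorElement_eq_one_iff_mul_comm] at h1
  exact h1.symm

theorem lowerCentralSeries_quotient_center {R : Type u} [Group R] {c : ℕ}
    (h : (⊤ : Subgroup R).lowerCentralSeries (c + 1) = ⊥) :
    (⊤ : Subgroup (R ⧸ Subgroup.center R)).lowerCentralSeries c = ⊥ := by
  rw [← Subgroup.map_top_of_surjective _ (QuotientGroup.mk'_surjective (Subgroup.center R)),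
    ← Subgroup.map_lowerCentralSeries, Subgroup.map_eq_bot_iff, QuotientGroup.ker_mk']
  exact lowerCentralSeries_le_center h

theorem IsRational.isRatCentralExt {R : Type u} [Group R] (hR : IsRational R) :
    IsRatCentralExt (QuotientGroup.mk' (Subgroup.center R)) := by
  refine ⟨QuotientGroup.mk'_surjective _, (QuotientGroup.ker_mk' _).le, ?_⟩
  rw [QuotientGroup.ker_mk']
  exact hR.center

/-! ### Constructions of local groups -/

/-- A group is local with respect to `f`. -/
def IsLocalFor {A B : Type u} [Group A] [Group B] (f : A →* B) (L : Type v) [Group L] : Prop :=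
  ∀ φ : A →* L, ∃! ψ : B →* L, ψ.comp f = φ

theorem isHQLocal_iff {L : Type u} [Group L] : IsHQLocal L ↔
    ∀ (A B : Type u) [Group A] [Group B] (f : A →* B), IsHQMap f → IsLocalFor f L := by
  refine forall₂_congr fun A B => forall₄_congr fun _ _ f _ => ?_
  exact Function.bijective_iff_existsUnique _

theorem IsHQLocal.isLocalFor {L : Type u} [Group L] (hL : IsHQLocal L) {A B : Type u} [Group A]
    [Group B] {f : A →* B} (hf : IsHQMap f) : IsLocalFor f L := isHQLocal_iff.1 hL A B f hf

theorem IsLocalFor.hom_ext {A B : Type u} [Group A] [Group B] {f : A →* B} {L : Type v} [Group L]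
    (h : IsLocalFor f L) {ψ ψ' : B →* L} (hψ : ψ.comp f = ψ'.comp f) : ψ = ψ' :=
  (h _).unique hψ rfl

/-- The total group of a rational central extension of a local group is local. -/
theorem IsLocalFor.of_isRatCentralExt {A B E C : Type u} [Group A] [Group B] [Group E] [Group C]
    {f : A →* B} (hf : IsHQMap f) {p : E →* C} (hp : IsRatCentralExt p) (hC : IsLocalFor f C) :
    IsLocalFor f E := by
  intro φ
  obtain ⟨χ, hχ, -⟩ := hC (p.comp φ)
  obtain ⟨ψ, hψ, hu⟩ := isHQMap_iff_isOrtho.1 hf _ _ p hp φ χ hχ.symm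
  exact ⟨ψ, hψ.1, fun ψ' hψ' => hu ψ' ⟨hψ', hC.hom_ext (by
    rw [MonoidHom.comp_assoc, hψ', hχ])⟩⟩

/-- Dividing by the center lowers the class, keeps the group rational, and is a central extension
with rational kernel; lifting then carries locality back up. -/
theorem isHQLocal_of_lowerCentralSeries_eq_bot (c : ℕ) : ∀ (N : Type u) [Group N],
    IsRational N → (⊤ : Subgroup N).lowerCentralSeries c = ⊥ → IsHQLocal N := by
  induction c with
  | zero =>
    intro N _ _ h
    have h' : (⊤ : Subgroup N) = ⊥ := h
    have hs : ∀ x : N, x = 1 := fun x => by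
      rw [← Subgroup.mem_bot, ← h']; trivial
    refine isHQLocal_iff.2 fun A B _ _ f _ φ => ⟨1, ?_, fun ψ _ => ?_⟩
    · ext a
      exact (hs _).symm
    · ext b
      exact hs _
  | succ c ih =>
    intro N _ hN h
    exact isHQLocal_iff.2 fun A B _ _ f hf => IsLocalFor.of_isRatCentralExt hf hN.isRatCentralExt
      ((ih _ hN.quotient_center (lowerCentralSeries_quotient_center h)).isLocalFor hf)

theorem isHQLocal_of_isNilpotent (N : Type u) [Group N] (hn : Group.IsNilpotent N)
    (hN : IsRational N) : IsHQLocal N := by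
  obtain ⟨c, hc⟩ := Subgroup.nilpotent_iff_lowerCentralSeries.1 hn
  exact isHQLocal_of_lowerCentralSeries_eq_bot c N hN hc

theorem isHQLocal_of_isLimit {J : Type v} [Category.{w} J] (F : J ⥤ GrpCat.{u})
    (hF : ∀ j, IsHQLocal (F.obj j)) (c : Limits.Cone F) (hc : Limits.IsLimit c) :
    IsHQLocal c.pt := by
  refine isHQLocal_iff.2 fun A B _ _ f hf φ => ?_
  have hloc := fun j => (hF j).isLocalFor hf
  choose ψ hψ _ using fun j => hloc j ((c.π.app j).hom.comp φ)
  let s : Limits.Cone F :=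
    { pt := GrpCat.of B
      π :=
        { app := fun j => GrpCat.ofHom (ψ j)
          naturality := fun i j g => by
            apply GrpCat.hom_ext
            apply (hloc j).hom_ext
            have h1 := congrArg GrpCat.Hom.hom (c.w g)
            rw [GrpCat.hom_comp] at h1
            change (ψ j).comp f = ((F.map g).hom.comp (ψ i)).comp f
            rw [MonoidHom.comp_assoc, hψ, hψ, ← MonoidHom.comp_assoc, h1] } }
  refine ⟨(hc.lift s).hom, ?_, fun ψ' hψ' => ?_⟩
  · have : GrpCat.ofHom ((hc.lift s).hom.comp f) = GrpCat.ofHom φ := by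
      apply hc.hom_ext
      intro j
      apply GrpCat.hom_ext
      have h1 := congrArg GrpCat.Hom.hom (hc.fac s j)
      rw [GrpCat.hom_comp] at h1
      change (c.π.app j).hom.comp ((hc.lift s).hom.comp f) = _
      rw [← MonoidHom.comp_assoc, h1]
      exact hψ j
    exact congrArg GrpCat.Hom.hom this
  · have : GrpCat.ofHom ψ' = hc.lift s := by
      apply hc.hom_ext
      intro j
      rw [hc.fac]
      apply GrpCat.hom_ext
      apply (hloc j).hom_ext
      change ((c.π.app j).hom.comp ψ').comp f = (ψ j).comp f
      rw [MonoidHom.comp_assoc, hψ', hψ]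
    exact congrArg GrpCat.Hom.hom this

theorem isHQLocal_bau_nilQuot (G : Type u) [Group G] (n : ℕ) : IsHQLocal (Bau (NilQuot G n)) :=
  isHQLocal_of_isNilpotent _ (Bau.isNilpotent _) (Bau.isRational _)

/-- The projection of the `ℚ`-completion to a stage of the tower. -/
def QCompletion.proj (G : Type u) [Group G] (n : ℕ) : QCompletion G →* Bau (NilQuot G n) where
  toFun x := x.1 n
  map_one' := rfl
  map_mul' _ _ := rfl

theorem QCompletion.isHQLocal (G : Type u) [Group G] : IsHQLocal (QCompletion G) := by
  refine isHQLocal_iff.2 fun A B _ _ f hf φ => ?_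
  have hloc := fun n => (isHQLocal_bau_nilQuot G n).isLocalFor hf
  choose ψ hψ _ using fun n => hloc n ((QCompletion.proj G n).comp φ)
  have hcompat : ∀ n, (Bau.map (NilQuot.proj G n)).comp (ψ (n + 1)) = ψ n := fun n =>
    (hloc n).hom_ext (by
      rw [MonoidHom.comp_assoc, hψ, hψ]
      ext a
      exact (φ a).2 n)
  refine ⟨MonoidHom.mk' (fun b => ⟨fun n => ψ n b, fun n => DFunLike.congr_fun (hcompat n) b⟩)
    fun b b' => Subtype.ext (funext fun n => map_mul (ψ n) b b'), ?_, fun ψ' hψ' => ?_⟩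
  · ext a n
    exact DFunLike.congr_fun (hψ n) a
  · have h1 : ∀ n, (QCompletion.proj G n).comp ψ' = ψ n := fun n => (hloc n).hom_ext (by
      rw [MonoidHom.comp_assoc, hψ', hψ])
    ext b n
    exact DFunLike.congr_fun (h1 n) b

/-! ### Reflection onto the groups that are local for a small family of homomorphisms -/

section reflection

variable {ι : Type u} (A B : ι → Type u) (G : Type u)

/-- Formal expressions in elements of `G`, the group operations and formal values of extensions
along a family of homomorphisms `A i → B i`. -/
inductive LocTerm : Type u
  | of (g : G) : LocTerm
  | one : LocTerm
  | mul (a b : LocTerm) : LocTerm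
  | inv (a : LocTerm) : LocTerm
  | ext (i : ι) (φ : A i → LocTerm) (b : B i) : LocTerm

variable {A B} [∀ i, Group (A i)] [∀ i, Group (B i)] (f : ∀ i, A i →* B i) [Group G]

/-- The least congruence making expressions into a group that receives a homomorphism from `G`
and is local with respect to the homomorphisms `f i`. -/
inductive LocRel : LocTerm A B G → LocTerm A B G → Prop
  | refl (a) : LocRel a a
  | symm {a b} : LocRel a b → LocRel b a
  | trans {a b c} : LocRel a b → LocRel b c → LocRel a c
  | mul_congr {a a' b b'} : LocRel a a' → LocRel b b' → LocRel (.mul a b) (.mul a' b')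
  | inv_congr {a a'} : LocRel a a' → LocRel (.inv a) (.inv a')
  | ext_congr (i) {φ φ'} (b) : (∀ a, LocRel (φ a) (φ' a)) → LocRel (.ext i φ b) (.ext i φ' b)
  | mul_assoc (a b c) : LocRel (.mul (.mul a b) c) (.mul a (.mul b c))
  | one_mul (a) : LocRel (.mul .one a) a
  | mul_one (a) : LocRel (.mul a .one) a
  | inv_mul (a) : LocRel (.mul (.inv a) a) .one
  | of_mul (g h : G) : LocRel (.of (g * h)) (.mul (.of g) (.of h))
  | ext_mul (i φ b b') : (∀ a a', LocRel (φ (a * a')) (.mul (φ a) (φ a'))) →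
      LocRel (.ext i φ (b * b')) (.mul (.ext i φ b) (.ext i φ b'))
  | ext_map (i φ a) : (∀ a a', LocRel (φ (a * a')) (.mul (φ a) (φ a'))) →
      LocRel (.ext i φ (f i a)) (φ a)
  | ext_unique (i) (ψ : B i → LocTerm A B G) (b) :
      (∀ b b', LocRel (ψ (b * b')) (.mul (ψ b) (ψ b'))) →
      LocRel (ψ b) (.ext i (fun a => ψ (f i a)) b)

/-- The setoid of the congruence `LocRel`. -/
def locSetoid : Setoid (LocTerm A B G) where
  r := LocRel G f
  iseqv := ⟨.refl, .symm, .trans⟩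

/-- A group that is local with respect to the homomorphisms `f i`, weakly initial among those
under `G`. -/
def WeakLoc : Type u := Quotient (locSetoid G f)

namespace WeakLoc

instance instGroup : Group (WeakLoc G f) where
  mul := Quotient.map₂ LocTerm.mul fun _ _ h _ _ h' => LocRel.mul_congr h h'
  one := Quotient.mk _ .one
  inv := Quotient.map LocTerm.inv fun _ _ h => LocRel.inv_congr h
  mul_assoc := by
    rintro ⟨a⟩ ⟨b⟩ ⟨c⟩
    exact Quotient.sound (LocRel.mul_assoc a b c)
  one_mul := by
    rintro ⟨a⟩
    exact Quotient.sound (LocRel.one_mul a)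
  mul_one := by
    rintro ⟨a⟩
    exact Quotient.sound (LocRel.mul_one a)
  inv_mul_cancel := by
    rintro ⟨a⟩
    exact Quotient.sound (LocRel.inv_mul a)

/-- The class of an expression. -/
def mk (a : LocTerm A B G) : WeakLoc G f := Quotient.mk (locSetoid G f) a

/-- The canonical homomorphism. -/
def of : G →* WeakLoc G f :=
  MonoidHom.mk' (fun g => mk G f (.of g)) fun g h => Quotient.sound (LocRel.of_mul g h)

/-- A homomorphism into the quotient becomes a term-valued function by choosing representatives,
which is multiplicative up to `LocRel`. The rules `ext_mul` and `ext_map` then give an extension,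
and `ext_unique` makes it the only one. -/
theorem isLocalFor (i : ι) : IsLocalFor (f i) (WeakLoc G f) := by
  intro φ
  have hout : ∀ x : WeakLoc G f, mk G f x.out = x := Quotient.out_eq
  have hrel : ∀ {X : Type u} [Group X] (χ : X →* WeakLoc G f) (x y : X),
      LocRel G f (χ (x * y)).out (.mul (χ x).out (χ y).out) := by
    intro X _ χ x y
    refine Quotient.exact (s := locSetoid G f) ?_
    change mk G f _ = mk G f (χ x).out * mk G f (χ y).out
    rw [hout, hout, hout, map_mul]
  refine ⟨MonoidHom.mk' (fun b => mk G f (.ext i (fun a => (φ a).out) b)) fun b b' =>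
    Quotient.sound (LocRel.ext_mul i _ b b' (hrel φ)), ?_, fun ψ hψ => ?_⟩
  · ext a
    refine Eq.trans ?_ (hout (φ a))
    exact Quotient.sound (LocRel.ext_map i (fun a => (φ a).out) a (hrel φ))
  · ext b
    refine (hout (ψ b)).symm.trans ?_
    refine (Quotient.sound (LocRel.ext_unique i (fun b => (ψ b).out) b (hrel ψ))).trans ?_
    have : (fun a => (ψ (f i a)).out) = fun a => (φ a).out := by
      funext a
      rw [← hψ]
      rfl
    rw [this]
    rfl

variable {G f} {L : Type u} [Group L] (hL : ∀ i, IsLocalFor (f i) L) (θ : G →* L)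

open Classical in
/-- The value at `b` of the extension along `f i` of a function on `A i`, if it is a
homomorphism. -/
noncomputable def extVal (i : ι) (φ : A i → L) (b : B i) : L :=
  -- The default `1` is harmless: the rules special to `ext`, apart from congruence, presuppose
  -- multiplicativity.
  if h : ∀ a a', φ (a * a') = φ a * φ a' then (hL i (MonoidHom.mk' φ h)).choose b else 1

/-- The value of an expression in a local group. -/
noncomputable def eval : LocTerm A B G → L
  | .of g => θ g
  | .one => 1
  | .mul a b => eval a * eval b
  | .inv a => (eval a)⁻¹
  | .ext i φ b => extVal hL i (fun a => eval (φ a)) b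

theorem eval_congr {a b : LocTerm A B G} (h : LocRel G f a b) :
    eval hL θ a = eval hL θ b := by
  induction h with
  | refl a => rfl
  | symm _ ih => exact ih.symm
  | trans _ _ ih ih' => exact ih.trans ih'
  | mul_congr _ _ ih ih' => simp only [eval, ih, ih']
  | inv_congr _ ih => simp only [eval, ih]
  | ext_congr i b _ ih => simp only [eval, ih]
  | mul_assoc a b c => simp only [eval, _root_.mul_assoc]
  | one_mul a => simp only [eval, _root_.one_mul]
  | mul_one a => simp only [eval, _root_.mul_one]
  | inv_mul a => simp only [eval, inv_mul_cancel]
  | of_mul g h => simp only [eval, map_mul]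
  | ext_mul i φ b b' _ ih =>
    simp only [eval, extVal] at ih ⊢
    rw [dif_pos ih, dif_pos ih, dif_pos ih, map_mul]
  | ext_map i φ a _ ih =>
    simp only [eval, extVal] at ih ⊢
    rw [dif_pos ih]
    exact DFunLike.congr_fun (hL i (MonoidHom.mk' (fun a => eval hL θ (φ a)) ih)).choose_spec.1 a
  | ext_unique i ψ b _ ih =>
    simp only [eval, extVal] at ih ⊢
    have h1 : ∀ a a', eval hL θ (ψ (f i (a * a'))) =
        eval hL θ (ψ (f i a)) * eval hL θ (ψ (f i a')) := fun a a' => by rw [map_mul, ih]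
    rw [dif_pos h1]
    have h2 := (hL i (MonoidHom.mk' (fun a => eval hL θ (ψ (f i a))) h1)).choose_spec.2
      (MonoidHom.mk' (fun b => eval hL θ (ψ b)) ih) rfl
    exact DFunLike.congr_fun h2 b

/-- The extension of a homomorphism to a local group along `WeakLoc.of`. -/
noncomputable def lift : WeakLoc G f →* L :=
  MonoidHom.mk' (Quotient.lift (eval hL θ) fun _ _ h => eval_congr hL θ h) (by
    rintro ⟨a⟩ ⟨b⟩
    rfl)

end WeakLoc

/-- `WeakLoc` contains unconstrained elements, the `ext` terms of non-multiplicative functions, so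
maps out of it need not be unique. The smallest subgroup containing the image of `G` and closed
under extension along the `f i` removes them. -/
theorem exists_reflection : ∃ (T : Type u) (_ : Group T) (η : G →* T),
    (∀ i, IsLocalFor (f i) T) ∧
      ∀ (L : Type u) [Group L], (∀ i, IsLocalFor (f i) L) → IsLocalFor η L := by
  let K := WeakLoc G f
  let IsClosed : Subgroup K → Prop := fun H =>
    ∀ i (ψ : B i →* K), (∀ a, ψ (f i a) ∈ H) → ∀ b, ψ b ∈ H
  let T : Subgroup K := sInf {H | IsClosed H ∧ (WeakLoc.of G f).range ≤ H}
  have hT : IsClosed T := by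
    intro i ψ h b
    refine Subgroup.mem_sInf.2 fun H hH => hH.1 i ψ (fun a => ?_) b
    exact Subgroup.mem_sInf.1 (h a) H hH
  have hG : (WeakLoc.of G f).range ≤ T := le_sInf fun H hH => hH.2
  refine ⟨T, inferInstance, (WeakLoc.of G f).codRestrict T fun g => hG ⟨g, rfl⟩, ?_, ?_⟩
  · intro i φ
    obtain ⟨ψ, hψ, hu⟩ := WeakLoc.isLocalFor G f i (T.subtype.comp φ)
    have hmem : ∀ b, ψ b ∈ T := hT i ψ fun a => by
      rw [show ψ (f i a) = φ a from DFunLike.congr_fun hψ a]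
      exact (φ a).2
    refine ⟨ψ.codRestrict T hmem, ?_, fun ψ' hψ' => ?_⟩
    · ext a
      exact DFunLike.congr_fun hψ a
    · have := hu (T.subtype.comp ψ') ((MonoidHom.comp_assoc _ _ _).trans (congrArg _ hψ'))
      ext b
      exact DFunLike.congr_fun this b
  · intro L _ hL θ
    refine ⟨(WeakLoc.lift hL θ).comp T.subtype, rfl, fun h hh => ?_⟩
    let h' : T →* L := (WeakLoc.lift hL θ).comp T.subtype
    -- The equalizer of two homomorphisms into a local group is itself closed, so minimality of `T`
    -- forces them to agree.
    have hle : T ≤ (h.eqLocus h').map T.subtype := by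
      refine sInf_le ⟨fun i ψ hψ b => ?_, ?_⟩
      · have hmem : ∀ b, ψ b ∈ T := hT i ψ fun a => by
          obtain ⟨x, -, hx⟩ := hψ a
          rw [← hx]
          exact x.2
        refine ⟨⟨ψ b, hmem b⟩, ?_, rfl⟩
        have h1 : h.comp (ψ.codRestrict T hmem) = h'.comp (ψ.codRestrict T hmem) :=
          (hL i).hom_ext (by
            ext a
            obtain ⟨x, hx, hxa⟩ := hψ a
            have h2 : ψ.codRestrict T hmem (f i a) = x := Subtype.ext hxa.symm
            change h (ψ.codRestrict T hmem (f i a)) = h' (ψ.codRestrict T hmem (f i a))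
            rw [h2]
            exact hx)
        exact DFunLike.congr_fun h1 b
      · rintro _ ⟨g, rfl⟩
        exact ⟨⟨WeakLoc.of G f g, hG ⟨g, rfl⟩⟩, DFunLike.congr_fun hh g, rfl⟩
    refine MonoidHom.ext fun x => ?_
    obtain ⟨y, hy, hyx⟩ := hle x.2
    rw [← Subtype.ext hyx]
    exact hy

end reflection

/-- If the homomorphisms `f i` are rationally `2`-acyclic, so is the reflection onto the groups
that are local for them. -/
theorem isHQMap_of_reflection {ι : Type u} {A B : ι → Type u} [∀ i, Group (A i)]
    [∀ i, Group (B i)] (f : ∀ i, A i →* B i) (hf : ∀ i, IsHQMap (f i)) {G T : Type u} [Group G]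
    [Group T] (η : G →* T) (hT : ∀ i, IsLocalFor (f i) T)
    (hη : ∀ (L : Type u) [Group L], (∀ i, IsLocalFor (f i) L) → IsLocalFor η L) :
    IsHQMap η := by
  rw [isHQMap_iff_isOrtho]
  intro E C _ _ p hp φ χ hsq
  -- Pulling the extension back along `χ` reduces a lifting problem for `η` to extending a
  -- homomorphism `G →* P` over `T`.
  let P : Subgroup (E × T) := (p.comp (MonoidHom.fst E T)).eqLocus (χ.comp (MonoidHom.snd E T))
  let pr₁ : P →* E := (MonoidHom.fst E T).comp P.subtype
  let pr₂ : P →* T := (MonoidHom.snd E T).comp P.subtype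
  have hpr : p.comp pr₁ = χ.comp pr₂ := MonoidHom.ext fun x => x.2
  have hext : ∀ {X : Type u} [Group X] (a b : X →* P), pr₁.comp a = pr₁.comp b →
      pr₂.comp a = pr₂.comp b → a = b := fun a b h1 h2 => MonoidHom.ext fun x =>
    Subtype.ext (Prod.ext (DFunLike.congr_fun h1 x) (DFunLike.congr_fun h2 x))
  have hmk : ∀ {X : Type u} [Group X] (a : X →* E) (b : X →* T), p.comp a = χ.comp b →
      ∃ c : X →* P, pr₁.comp c = a ∧ pr₂.comp c = b := fun a b h =>
    ⟨(a.prod b).codRestrict P fun x => DFunLike.congr_fun h x, rfl, rfl⟩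
  -- Extend the component in `T` first, by locality of `T`; then lift the component in `E` against
  -- `p`.
  have hP : ∀ i, IsLocalFor (f i) P := by
    intro i φ
    obtain ⟨τ, hτ, hτu⟩ := hT i (pr₂.comp φ)
    obtain ⟨ψ, ⟨hψ1, hψ2⟩, hψu⟩ := isHQMap_iff_isOrtho.1 (hf i) _ _ p hp (pr₁.comp φ) (χ.comp τ)
      (by
        rw [MonoidHom.comp_assoc (f i) τ χ, hτ, ← MonoidHom.comp_assoc φ pr₁ p, hpr,
          MonoidHom.comp_assoc φ pr₂ χ])
    obtain ⟨c, hc1, hc2⟩ := hmk ψ τ hψ2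
    refine ⟨c, hext _ _ ?_ ?_, fun c' hc' => ?_⟩
    · rw [← MonoidHom.comp_assoc, hc1, hψ1]
    · rw [← MonoidHom.comp_assoc, hc2, hτ]
    · have h2 : pr₂.comp c' = τ := hτu _ ((MonoidHom.comp_assoc _ _ _).trans (congrArg _ hc'))
      refine hext _ _ ?_ (h2.trans hc2.symm)
      refine (hψu _ ⟨?_, ?_⟩).trans hc1.symm
      · exact (MonoidHom.comp_assoc _ _ _).trans (congrArg _ hc')
      · rw [← MonoidHom.comp_assoc, hpr, MonoidHom.comp_assoc, h2]
  obtain ⟨c, hc1, hc2⟩ := hmk φ η hsq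
  obtain ⟨κ, hκ, -⟩ := hη P hP c
  -- The extension `κ` is a section of the pulled-back extension, so its component in `E` lies over
  -- `χ`.
  have hκ2 : pr₂.comp κ = MonoidHom.id T := (hη T hT).hom_ext (by
    rw [MonoidHom.comp_assoc, hκ, hc2, MonoidHom.id_comp])
  refine ⟨pr₁.comp κ, ⟨by rw [MonoidHom.comp_assoc, hκ, hc1], ?_⟩, fun ψ hψ => ?_⟩
  · rw [← MonoidHom.comp_assoc, hpr, MonoidHom.comp_assoc, hκ2, MonoidHom.comp_id]
  · obtain ⟨d, hd1, hd2⟩ := hmk ψ (MonoidHom.id T) hψ.2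
    have : d = κ := (hη P hP).hom_ext (hext _ _ (by
      rw [← MonoidHom.comp_assoc, hd1, hψ.1, hκ, hc1]) (by
      rw [← MonoidHom.comp_assoc, hd2, hκ, hc2, MonoidHom.id_comp]))
    rw [← hd1, this]

/-! ### Countable approximation of rationally acyclic homomorphisms -/

/-- A countable set is contained in a countable set that is closed under a countably valued
finitary operation. -/
theorem exists_countable_closed {X : Type*} (w : Finset X → Set X) (hw : ∀ s, (w s).Countable)
    (S : Set X) (hS : S.Countable) :
    ∃ T : Set X, S ⊆ T ∧ T.Countable ∧ ∀ s : Finset X, (s : Set X) ⊆ T → w s ⊆ T := by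
  classical
  let step : Set X → Set X := fun T => T ∪ ⋃ s : {s : Finset X // (s : Set X) ⊆ T}, w s
  have hstep : ∀ T, T.Countable → (step T).Countable := by
    intro T hT
    refine hT.union ?_
    have : Countable {s : Finset X // (s : Set X) ⊆ T} := by
      have := hT.to_subtype
      have hinj : Function.Injective fun s : {s : Finset X // (s : Set X) ⊆ T} =>
          s.1.subtype (· ∈ T) := by
        intro s t hst
        refine Subtype.ext (Finset.ext fun x => ?_)
        constructor
        · intro hx
          have : (⟨x, s.2 hx⟩ : T) ∈ t.1.subtype (· ∈ T) := by
            rw [← show s.1.subtype (· ∈ T) = t.1.subtype (· ∈ T) from hst]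
            exact Finset.mem_subtype.2 hx
          exact Finset.mem_subtype.1 this
        · intro hx
          have : (⟨x, t.2 hx⟩ : T) ∈ s.1.subtype (· ∈ T) := by
            rw [show s.1.subtype (· ∈ T) = t.1.subtype (· ∈ T) from hst]
            exact Finset.mem_subtype.2 hx
          exact Finset.mem_subtype.1 this
      exact hinj.countable
    exact Set.countable_iUnion fun s => hw s
  let t : ℕ → Set X := fun n => step^[n] S
  have hsucc : ∀ n, t (n + 1) = step (t n) := fun n => Function.iterate_succ_apply' _ _ _
  have hmono : Monotone t := monotone_nat_of_le_succ fun n => by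
    rw [hsucc]; exact Set.subset_union_left
  have hc : ∀ n, (t n).Countable := fun n => by
    induction n with
    | zero => exact hS
    | succ n ih => rw [hsucc]; exact hstep _ ih
  refine ⟨⋃ n, t n, Set.subset_iUnion t 0, Set.countable_iUnion hc, fun s hs => ?_⟩
  obtain ⟨n, hn⟩ := (hmono.directed_le).exists_mem_subset_of_finset_subset_biUnion hs
  refine Set.Subset.trans ?_ (Set.subset_iUnion t (n + 1))
  rw [hsucc]
  exact Set.Subset.trans (Set.subset_iUnion (fun s : {s : Finset X // (s : Set X) ⊆ t n} => w s)
    ⟨s, hn⟩) Set.subset_union_right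

theorem countable_setOf_support_subset {X : Type u} (s : Set X) (hs : s.Countable) :
    {x : X →₀ QQ.{u} | (x.support : Set X) ⊆ s}.Countable := by
  have := hs.to_subtype
  have h : Countable (Finsupp.supported QQ.{u} QQ.{u} s) :=
    (Finsupp.supportedEquivFinsupp (M := QQ.{u}) (R := QQ.{u}) s).injective.countable
  exact h.to_set

/-- The entries of the simplices of a `2`-chain. -/
def verts₂ {G : Type u} (x : G × G →₀ QQ.{u}) : Set G :=
  Prod.fst '' (x.support : Set (G × G)) ∪ Prod.snd '' (x.support : Set (G × G))

/-- The entries of the simplices of a `3`-chain. -/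
def verts₃ {G : Type u} (x : G × G × G →₀ QQ.{u}) : Set G :=
  Prod.fst '' (x.support : Set (G × G × G)) ∪
    ((fun g => g.2.1) '' (x.support : Set (G × G × G)) ∪
      (fun g => g.2.2) '' (x.support : Set (G × G × G)))

theorem verts₂_countable {G : Type u} (x : G × G →₀ QQ.{u}) : (verts₂ x).Countable :=
  (x.support.countable_toSet.image _).union (x.support.countable_toSet.image _)

theorem verts₃_countable {G : Type u} (x : G × G × G →₀ QQ.{u}) : (verts₃ x).Countable :=
  (x.support.countable_toSet.image _).union
    ((x.support.countable_toSet.image _).union (x.support.countable_toSet.image _))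

/-! ### Chains supported in a subgroup -/

section subgroupChains

variable {G : Type u} [Group G] (H : Subgroup G)

theorem exists_ch₁_eq (x : G →₀ QQ.{u}) (hx : (x.support : Set G) ⊆ H) :
    ∃ y, ch₁ H.subtype y = x :=
  ⟨_, Finsupp.mapDomain_comapDomain _ H.subtype_injective x fun g hg => ⟨⟨g, hx hg⟩, rfl⟩⟩

theorem exists_ch₂_eq (x : G × G →₀ QQ.{u}) (hx : verts₂ x ⊆ H) :
    ∃ y, ch₂ H.subtype y = x :=
  ⟨_, Finsupp.mapDomain_comapDomain _ (H.subtype_injective.prodMap H.subtype_injective) x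
    fun g hg => ⟨(⟨g.1, hx (Or.inl ⟨g, hg, rfl⟩)⟩, ⟨g.2, hx (Or.inr ⟨g, hg, rfl⟩)⟩), rfl⟩⟩

theorem exists_ch₃_eq (x : G × G × G →₀ QQ.{u}) (hx : verts₃ x ⊆ H) :
    ∃ y, ch₃ H.subtype y = x :=
  ⟨_, Finsupp.mapDomain_comapDomain _
    (H.subtype_injective.prodMap (H.subtype_injective.prodMap H.subtype_injective)) x
    fun g hg => ⟨(⟨g.1, hx (Or.inl ⟨g, hg, rfl⟩)⟩, ⟨g.2.1, hx (Or.inr (Or.inl ⟨g, hg, rfl⟩))⟩,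
      ⟨g.2.2, hx (Or.inr (Or.inr ⟨g, hg, rfl⟩))⟩), rfl⟩⟩

theorem ch₁_subtype_injective : Function.Injective (ch₁ H.subtype) :=
  Finsupp.mapDomain_injective H.subtype_injective

theorem ch₂_subtype_injective : Function.Injective (ch₂ H.subtype) :=
  Finsupp.mapDomain_injective (H.subtype_injective.prodMap H.subtype_injective)

theorem support_ch₁_subset (x : H →₀ QQ.{u}) :
    ((ch₁ H.subtype x).support : Set G) ⊆ H := by
  classical
  intro g hg
  obtain ⟨h, -, rfl⟩ := Finset.mem_image.1 (Finsupp.mapDomain_support hg)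
  exact h.2

theorem verts₂_ch₂_subset (x : H × H →₀ QQ.{u}) : verts₂ (ch₂ H.subtype x) ⊆ H := by
  classical
  rintro g (⟨p, hp, rfl⟩ | ⟨p, hp, rfl⟩)
  · obtain ⟨h, -, rfl⟩ := Finset.mem_image.1 (Finsupp.mapDomain_support hp)
    exact h.1.2
  · obtain ⟨h, -, rfl⟩ := Finset.mem_image.1 (Finsupp.mapDomain_support hp)
    exact h.2.2

end subgroupChains

theorem ch₁_comp {G H K : Type u} [Group G] [Group H] [Group K] (g : H →* K) (f : G →* H)
    (x : G →₀ QQ.{u}) : ch₁ (g.comp f) x = ch₁ g (ch₁ f x) :=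
  Finsupp.mapDomain_comp (f := f) (g := g)

theorem ch₂_comp {G H K : Type u} [Group G] [Group H] [Group K] (g : H →* K) (f : G →* H)
    (x : G × G →₀ QQ.{u}) : ch₂ (g.comp f) x = ch₂ g (ch₂ f x) :=
  Finsupp.mapDomain_comp (f := Prod.map f f) (g := Prod.map g g)

section approximation

variable {A B : Type u} [Group A] [Group B] (f : A →* B)

/-- The restriction of a homomorphism to subgroups. -/
def restr (A' : Subgroup A) (B' : Subgroup B) (h : ∀ a ∈ A', f a ∈ B') : A' →* B' :=
  (f.comp A'.subtype).codRestrict B' fun a => h a a.2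

/-- A Löwenheim–Skolem argument: choose witnesses for the three chain conditions and close up under
their vertices, the group operations and `f`. Only countably many chains live on a finite set of
vertices, since ℚ is countable, so the closure stays countable. -/
theorem exists_countable_isHQMap (hf : IsHQMap f) (S : Set A) (hS : S.Countable) (T : Set B)
    (hT : T.Countable) : ∃ (A' : Subgroup A) (B' : Subgroup B) (h : ∀ a ∈ A', f a ∈ B'),
      S ⊆ A' ∧ T ⊆ B' ∧ Countable A' ∧ Countable B' ∧ IsHQMap (restr f A' B' h) := by
  classical
  rw [isHQMap_iff_chains] at hf
  -- Witnesses are chosen for all chains at once, with value `0` where the premise fails, so that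
  -- they become total functions.
  have h1 : ∀ x : A →₀ QQ.{u}, ∃ z, (∃ y, ch₁ f x = bd₂ B y) → x = bd₂ A z := fun x => by
    by_cases h : ∃ y, ch₁ f x = bd₂ B y
    · obtain ⟨y, hy⟩ := h
      obtain ⟨z, hz⟩ := hf.inj₁ x y hy
      exact ⟨z, fun _ => hz⟩
    · exact ⟨0, fun h' => absurd h' h⟩
  choose p hp using h1
  choose q r hqr using hf.surj₁
  have h3 : ∀ x : B × B →₀ QQ.{u}, ∃ y z, bd₂ B x = 0 →
      bd₂ A y = 0 ∧ x = ch₂ f y + bd₃ B z := fun x => by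
    by_cases h : bd₂ B x = 0
    · obtain ⟨y, z, hyz⟩ := hf.surj₂ x h
      exact ⟨y, z, fun _ => hyz⟩
    · exact ⟨0, 0, fun h' => absurd h' h⟩
  choose s t hst using h3
  -- The closure takes place in `A ⊕ B`, because the conditions move back and forth between the two
  -- groups.
  let wA : Finset (A ⊕ B) → Set A := fun F =>
    {1} ∪ (fun g : A × A => g.1 * g.2⁻¹) '' (F.toLeft ×ˢ F.toLeft : Finset (A × A)) ∪
      (⋃ x ∈ {x : A →₀ QQ.{u} | (x.support : Set A) ⊆ F.toLeft}, verts₂ (p x)) ∪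
      (⋃ x ∈ {x : B →₀ QQ.{u} | (x.support : Set B) ⊆ F.toRight}, ((q x).support : Set A)) ∪
      ⋃ x ∈ {x : B × B →₀ QQ.{u} | (x.support : Set (B × B)) ⊆
        (F.toRight ×ˢ F.toRight : Finset (B × B))}, verts₂ (s x)
  let wB : Finset (A ⊕ B) → Set B := fun F =>
    {1} ∪ (fun g : B × B => g.1 * g.2⁻¹) '' (F.toRight ×ˢ F.toRight : Finset (B × B)) ∪
      f '' F.toLeft ∪
      (⋃ x ∈ {x : B →₀ QQ.{u} | (x.support : Set B) ⊆ F.toRight}, verts₂ (r x)) ∪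
      ⋃ x ∈ {x : B × B →₀ QQ.{u} | (x.support : Set (B × B)) ⊆
        (F.toRight ×ˢ F.toRight : Finset (B × B))}, verts₃ (t x)
  have hwA : ∀ F, (wA F).Countable := fun F =>
    (((((Set.countable_singleton _).union ((Finset.countable_toSet _).image _)).union
      ((countable_setOf_support_subset _ (Finset.countable_toSet _)).biUnion
        fun x _ => verts₂_countable _)).union
      ((countable_setOf_support_subset _ (Finset.countable_toSet _)).biUnion
        fun x _ => Finset.countable_toSet _)).union
      ((countable_setOf_support_subset _ (Finset.countable_toSet _)).biUnion
        fun x _ => verts₂_countable _))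
  have hwB : ∀ F, (wB F).Countable := fun F =>
    (((((Set.countable_singleton _).union ((Finset.countable_toSet _).image _)).union
      ((Finset.countable_toSet _).image _)).union
      ((countable_setOf_support_subset _ (Finset.countable_toSet _)).biUnion
        fun x _ => verts₂_countable _)).union
      ((countable_setOf_support_subset _ (Finset.countable_toSet _)).biUnion
        fun x _ => verts₃_countable _))
  obtain ⟨X, hSX, hX, hcl⟩ := exists_countable_closed
    (fun F => Sum.inl '' wA F ∪ Sum.inr '' wB F)
    (fun F => ((hwA F).image _).union ((hwB F).image _))
    (Sum.inl '' S ∪ Sum.inr '' T) ((hS.image _).union (hT.image _))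
  have hclA : ∀ F : Finset (A ⊕ B), (F : Set (A ⊕ B)) ⊆ X → ∀ a ∈ wA F, Sum.inl a ∈ X :=
    fun F hF a ha => hcl F hF (Or.inl ⟨a, ha, rfl⟩)
  have hclB : ∀ F : Finset (A ⊕ B), (F : Set (A ⊕ B)) ⊆ X → ∀ b ∈ wB F, Sum.inr b ∈ X :=
    fun F hF b hb => hcl F hF (Or.inr ⟨b, hb, rfl⟩)
  have h1A : Sum.inl 1 ∈ X := hclA ∅ (by simp) 1 (by simp [wA])
  have h1B : Sum.inr 1 ∈ X := hclB ∅ (by simp) 1 (by simp [wB])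
  have hdA : ∀ a a', Sum.inl a ∈ X → Sum.inl a' ∈ X → Sum.inl (a * a'⁻¹) ∈ X := by
    intro a a' h h'
    refine hclA {Sum.inl a, Sum.inl a'} (by simp [Set.insert_subset_iff, h, h']) _ ?_
    refine Or.inl (Or.inl (Or.inl (Or.inr ⟨(a, a'), ?_, rfl⟩)))
    simp
  have hdB : ∀ a a', Sum.inr a ∈ X → Sum.inr a' ∈ X → Sum.inr (a * a'⁻¹) ∈ X := by
    intro a a' h h'
    refine hclB {Sum.inr a, Sum.inr a'} (by simp [Set.insert_subset_iff, h, h']) _ ?_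
    refine Or.inl (Or.inl (Or.inl (Or.inr ⟨(a, a'), ?_, rfl⟩)))
    simp
  let A' : Subgroup A := Subgroup.ofDiv {a | Sum.inl a ∈ X} ⟨1, h1A⟩ fun a h a' h' => hdA a a' h h'
  let B' : Subgroup B := Subgroup.ofDiv {b | Sum.inr b ∈ X} ⟨1, h1B⟩ fun a h a' h' => hdB a a' h h'
  have hfAB : ∀ a ∈ A', f a ∈ B' := by
    intro a ha
    have ha' : Sum.inl a ∈ X := ha
    refine hclB {Sum.inl a} (by simpa using ha') _ ?_
    exact Or.inl (Or.inl (Or.inr ⟨a, by simp, rfl⟩))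
  have hmapA : ∀ F : Finset A, (F : Set A) ⊆ A' → ∀ a ∈ wA (F.disjSum ∅), a ∈ A' := by
    intro F hF
    refine hclA _ fun x hx => ?_
    obtain ⟨a, ha, rfl⟩ : ∃ a ∈ F, Sum.inl a = x := by simpa using hx
    exact hF ha
  have hmapB : ∀ F : Finset B, (F : Set B) ⊆ B' →
      (((∅ : Finset A).disjSum F : Finset (A ⊕ B)) : Set (A ⊕ B)) ⊆ X := by
    intro F hF x hx
    obtain ⟨a, ha, rfl⟩ : ∃ a ∈ F, Sum.inr a = x := by simpa using hx
    exact hF ha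
  refine ⟨A', B', hfAB, fun a ha => hSX (Or.inl ⟨a, ha, rfl⟩),
    fun b hb => hSX (Or.inr ⟨b, hb, rfl⟩), ?_, ?_, ?_⟩
  · exact (hX.preimage Sum.inl_injective).to_subtype
  · exact (hX.preimage Sum.inr_injective).to_subtype
  rw [isHQMap_iff_chains]
  have hcomm : B'.subtype.comp (restr f A' B' hfAB) = f.comp A'.subtype := rfl
  have hcomm₁ : ∀ x, ch₁ B'.subtype (ch₁ (restr f A' B' hfAB) x) = ch₁ f (ch₁ A'.subtype x) :=
    fun x => by rw [← ch₁_comp, hcomm, ch₁_comp]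
  have hcomm₂ : ∀ x, ch₂ B'.subtype (ch₂ (restr f A' B' hfAB) x) = ch₂ f (ch₂ A'.subtype x) :=
    fun x => by rw [← ch₂_comp, hcomm, ch₂_comp]
  -- In each case the chosen witness has its vertices in the subgroup, so it lifts to a chain there;
  -- the required identity descends because the inclusion is injective on chains.
  refine ⟨fun x y hxy => ?_, fun x => ?_, fun x hx => ?_⟩
  · have h1 := hp (ch₁ A'.subtype x) ⟨ch₂ B'.subtype y, by
      rw [← hcomm₁, hxy, bd₂_ch₂]⟩
    obtain ⟨z, hz⟩ := exists_ch₂_eq A' (p (ch₁ A'.subtype x)) fun a ha =>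
      hmapA _ (support_ch₁_subset A' x) a (Or.inl (Or.inl (Or.inr
        (Set.mem_biUnion (x := ch₁ A'.subtype x) (fun g hg => by simpa using hg) ha))))
    refine ⟨z, ch₁_subtype_injective A' ?_⟩
    rw [← bd₂_ch₂, hz, ← h1]
  · have h1 := hqr (ch₁ B'.subtype x)
    have hX := hmapB _ (support_ch₁_subset B' x)
    obtain ⟨y, hy⟩ := exists_ch₁_eq A' (q (ch₁ B'.subtype x)) fun a ha =>
      hclA _ hX a (Or.inl (Or.inr (Set.mem_biUnion (x := ch₁ B'.subtype x)
        (fun g hg => by simpa using hg) ha)))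
    obtain ⟨z, hz⟩ := exists_ch₂_eq B' (r (ch₁ B'.subtype x)) fun b hb =>
      hclB _ hX b (Or.inl (Or.inr (Set.mem_biUnion (x := ch₁ B'.subtype x)
        (fun g hg => by simpa using hg) hb)))
    refine ⟨y, z, ch₁_subtype_injective B' ?_⟩
    rw [map_add, hcomm₁, ← bd₂_ch₂, hy, hz, ← h1]
  · obtain ⟨hbd, h1⟩ := hst (ch₂ B'.subtype x) (by rw [bd₂_ch₂, hx, map_zero])
    let F : Finset B := (ch₂ B'.subtype x).support.image Prod.fst ∪
      (ch₂ B'.subtype x).support.image Prod.snd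
    have hX := hmapB F fun b hb => verts₂_ch₂_subset B' x (by simpa [F, verts₂] using hb)
    have hF : ((ch₂ B'.subtype x).support : Set (B × B)) ⊆
        ((((∅ : Finset A).disjSum F).toRight ×ˢ ((∅ : Finset A).disjSum F).toRight :
          Finset (B × B)) : Set (B × B)) := by
      intro g hg
      rw [Finset.toRight_disjSum]
      exact Finset.mem_coe.2 (Finset.mem_product.2
        ⟨Finset.mem_union_left _ (Finset.mem_image_of_mem _ hg),
          Finset.mem_union_right _ (Finset.mem_image_of_mem _ hg)⟩)
    obtain ⟨y, hy⟩ := exists_ch₂_eq A' (s (ch₂ B'.subtype x)) fun a ha =>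
      hclA _ hX a (Or.inr (Set.mem_biUnion (x := ch₂ B'.subtype x) hF ha))
    obtain ⟨z, hz⟩ := exists_ch₃_eq B' (t (ch₂ B'.subtype x)) fun b hb =>
      hclB _ hX b (Or.inr (Set.mem_biUnion (x := ch₂ B'.subtype x) hF hb))
    refine ⟨y, z, ch₁_subtype_injective A' ?_, ch₂_subtype_injective B' ?_⟩
    · rw [← bd₂_ch₂, hy, hbd, map_zero]
    · rw [map_add, hcomm₂, ← bd₃_ch₃, hy, hz, ← h1]

end approximation

/-! ### Existence of the localization -/

theorem IsHQMap.comp_mulEquiv {A₀ A B B₀ : Type u} [Group A₀] [Group A] [Group B] [Group B₀]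
    {f : A →* B} (hf : IsHQMap f) (e : A₀ ≃* A) (e' : B ≃* B₀) :
    IsHQMap ((e'.toMonoidHom.comp f).comp e.toMonoidHom) := by
  rw [isHQMap_iff_isOrtho] at hf ⊢
  intro E C _ _ p hp φ χ hsq
  obtain ⟨ψ, ⟨hψ1, hψ2⟩, hψu⟩ := hf E C p hp (φ.comp e.symm.toMonoidHom)
    (χ.comp e'.toMonoidHom) (by
      ext a
      have := DFunLike.congr_fun hsq (e.symm a)
      simpa using this)
  refine ⟨ψ.comp e'.symm.toMonoidHom, ⟨?_, ?_⟩, fun ψ' hψ' => ?_⟩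
  · ext a
    have := DFunLike.congr_fun hψ1 (e a)
    simpa using this
  · ext b
    have := DFunLike.congr_fun hψ2 (e'.symm b)
    simpa using this
  · have := hψu (ψ'.comp e'.toMonoidHom) ⟨by
      ext a
      have := DFunLike.congr_fun hψ'.1 (e.symm a)
      simpa using this, by rw [← MonoidHom.comp_assoc, hψ'.2]⟩
    rw [← this]
    ext b
    simp

theorem IsLocalFor.of_comp_mulEquiv {A₀ A B B₀ : Type u} [Group A₀] [Group A] [Group B]
    [Group B₀] {f : A →* B} (e : A₀ ≃* A) (e' : B ≃* B₀) {L : Type v} [Group L]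
    (h : IsLocalFor ((e'.toMonoidHom.comp f).comp e.toMonoidHom) L) : IsLocalFor f L := by
  intro φ
  obtain ⟨ψ, hψ, hψu⟩ := h (φ.comp e.toMonoidHom)
  refine ⟨ψ.comp e'.toMonoidHom, ?_, fun ψ' hψ' => ?_⟩
  · ext a
    have := DFunLike.congr_fun hψ (e.symm a)
    simpa using this
  · have := hψu (ψ'.comp e'.symm.toMonoidHom) (by
      ext a
      have := DFunLike.congr_fun hψ' (e a)
      simpa using this)
    rw [← this]
    ext b
    simp

/-- The free group on countably many generators, in the universe `u`. -/
abbrev FreeCtbl : Type u := FreeGroup (ULift.{u} ℕ)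

/-- A rationally `2`-acyclic homomorphism between countable groups given by presentations. -/
structure CtblHQMap : Type u where
  N : Subgroup FreeCtbl.{u}
  M : Subgroup FreeCtbl.{u}
  normal_N : N.Normal
  normal_M : M.Normal
  hom : FreeCtbl.{u} ⧸ N →* FreeCtbl.{u} ⧸ M
  isHQMap : IsHQMap hom

attribute [instance] CtblHQMap.normal_N CtblHQMap.normal_M

/-- This is what makes the homomorphisms between countable groups, up to isomorphism, into the small
family `CtblHQMap`. -/
theorem exists_mulEquiv_quotient (A : Type u) [Group A] [Countable A] :
    ∃ (N : Subgroup FreeCtbl.{u}) (_ : N.Normal), Nonempty (FreeCtbl.{u} ⧸ N ≃* A) := by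
  obtain ⟨s, hs⟩ := exists_surjective_nat A
  let π : FreeCtbl.{u} →* A := FreeGroup.lift fun n => s n.down
  have hπ : Function.Surjective π := fun a => by
    obtain ⟨n, rfl⟩ := hs a
    exact ⟨FreeGroup.of ⟨n⟩, FreeGroup.lift_apply_of⟩
  exact ⟨π.ker, inferInstance, ⟨QuotientGroup.quotientKerEquivOfSurjective π hπ⟩⟩

theorem isLocalFor_of_countable {L : Type u} [Group L]
    (hL : ∀ s : CtblHQMap.{u}, IsLocalFor s.hom L) {A B : Type u} [Group A] [Group B]
    [Countable A] [Countable B] {f : A →* B} (hf : IsHQMap f) : IsLocalFor f L := by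
  obtain ⟨N, _, ⟨e⟩⟩ := exists_mulEquiv_quotient A
  obtain ⟨M, _, ⟨e'⟩⟩ := exists_mulEquiv_quotient B
  exact IsLocalFor.of_comp_mulEquiv e e'.symm
    (hL ⟨N, M, inferInstance, inferInstance, _, hf.comp_mulEquiv e e'.symm⟩)

/-- The countable rationally 2-acyclic pieces of `f` contain any prescribed countable sets. On each
piece `φ` extends uniquely, and uniqueness glues the extensions to a homomorphism on `B`. -/
theorem isHQLocal_of_isLocalFor {L : Type u} [Group L]
    (hL : ∀ s : CtblHQMap.{u}, IsLocalFor s.hom L) : IsHQLocal L := by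
  refine isHQLocal_iff.2 fun A B _ _ f hf φ => ?_
  have hsub : ∀ S : Set A, S.Countable → ∀ T : Set B, T.Countable →
      ∃ (A' : Subgroup A) (B' : Subgroup B) (h : ∀ a ∈ A', f a ∈ B'),
        S ⊆ A' ∧ T ⊆ B' ∧ Countable A' ∧ Countable B' ∧ IsLocalFor (restr f A' B' h) L := by
    intro S hS T hT
    obtain ⟨A', B', h, hSA, hTB, _, _, hr⟩ := exists_countable_isHQMap f hf S hS T hT
    exact ⟨A', B', h, hSA, hTB, inferInstance, inferInstance, isLocalFor_of_countable hL hr⟩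
  have hval : ∀ b : B, ∃ y : L, ∀ (A' : Subgroup A) (B' : Subgroup B) (h : ∀ a ∈ A', f a ∈ B'),
      Countable A' → Countable B' → IsLocalFor (restr f A' B' h) L → ∀ (hb : b ∈ B')
      (ψ : B' →* L), ψ.comp (restr f A' B' h) = φ.comp A'.subtype → ψ ⟨b, hb⟩ = y := by
    intro b
    obtain ⟨A₁, B₁, h₁, -, hb₁, hA₁, hB₁, hl₁⟩ := hsub ∅ Set.countable_empty {b}
      (Set.countable_singleton b)
    obtain ⟨ψ₁, hψ₁, -⟩ := hl₁ (φ.comp A₁.subtype)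
    refine ⟨ψ₁ ⟨b, hb₁ rfl⟩, fun A₂ B₂ h₂ hA₂ hB₂ hl₂ hb₂ ψ₂ hψ₂ => ?_⟩
    -- Two pieces are compared inside a third that contains both: the extension on it restricts to
    -- the unique extension on either.
    obtain ⟨A₃, B₃, h₃, hA, hB, hA₃, hB₃, hl₃⟩ := hsub (A₁ ∪ A₂)
      (Set.Countable.union hA₁.to_set hA₂.to_set) (B₁ ∪ B₂)
      (Set.Countable.union hB₁.to_set hB₂.to_set)
    obtain ⟨ψ₃, hψ₃, -⟩ := hl₃ (φ.comp A₃.subtype)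
    have hA13 : A₁ ≤ A₃ := fun x hx => hA (Or.inl hx)
    have hA23 : A₂ ≤ A₃ := fun x hx => hA (Or.inr hx)
    have hB13 : B₁ ≤ B₃ := fun x hx => hB (Or.inl hx)
    have hB23 : B₂ ≤ B₃ := fun x hx => hB (Or.inr hx)
    have e1 : ψ₃.comp (Subgroup.inclusion hB13) = ψ₁ := hl₁.hom_ext (by
      rw [hψ₁]
      ext a
      exact DFunLike.congr_fun hψ₃ ⟨a, hA13 a.2⟩)
    have e2 : ψ₃.comp (Subgroup.inclusion hB23) = ψ₂ := hl₂.hom_ext (by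
      rw [hψ₂]
      ext a
      exact DFunLike.congr_fun hψ₃ ⟨a, hA23 a.2⟩)
    rw [← e1, ← e2]
    rfl
  choose y hy using hval
  refine ⟨MonoidHom.mk' y fun b b' => ?_, ?_, fun ψ hψ => ?_⟩
  · obtain ⟨A₁, B₁, h₁, -, hb₁, hA₁, hB₁, hl₁⟩ := hsub ∅ Set.countable_empty {b, b'}
      (by simp)
    obtain ⟨ψ₁, hψ₁, -⟩ := hl₁ (φ.comp A₁.subtype)
    have hb : b ∈ B₁ := hb₁ (by simp)
    have hb' : b' ∈ B₁ := hb₁ (by simp)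
    rw [← hy b A₁ B₁ h₁ hA₁ hB₁ hl₁ hb ψ₁ hψ₁, ← hy b' A₁ B₁ h₁ hA₁ hB₁ hl₁ hb' ψ₁ hψ₁,
      ← hy (b * b') A₁ B₁ h₁ hA₁ hB₁ hl₁ (B₁.mul_mem hb hb') ψ₁ hψ₁, ← map_mul]
    rfl
  · ext a
    obtain ⟨A₁, B₁, h₁, ha, -, hA₁, hB₁, hl₁⟩ := hsub {a} (Set.countable_singleton a) ∅
      Set.countable_empty
    obtain ⟨ψ₁, hψ₁, -⟩ := hl₁ (φ.comp A₁.subtype)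
    refine (hy (f a) A₁ B₁ h₁ hA₁ hB₁ hl₁ (h₁ a (ha rfl)) ψ₁ hψ₁).symm.trans ?_
    exact DFunLike.congr_fun hψ₁ ⟨a, ha rfl⟩
  · ext b
    obtain ⟨A₁, B₁, h₁, -, hb₁, hA₁, hB₁, hl₁⟩ := hsub ∅ Set.countable_empty {b}
      (Set.countable_singleton b)
    refine hy b A₁ B₁ h₁ hA₁ hB₁ hl₁ (hb₁ rfl) (ψ.comp B₁.subtype) ?_
    ext a
    exact DFunLike.congr_fun hψ a.1

theorem exists_isHQLocalization (G : Type u) [Group G] :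
    ∃ (L : Type u) (_ : Group L) (η : G →* L), IsHQLocalization η := by
  obtain ⟨T, _, η, hT, hη⟩ := exists_reflection G fun s : CtblHQMap.{u} => s.hom
  exact ⟨T, inferInstance, η, isHQMap_of_reflection _ (fun s => s.isHQMap) η hT hη,
    isHQLocal_of_isLocalFor hT⟩

theorem exists_isHQLocalizationFunctor :
    ∃ (ℓ : GrpCat.{u} ⥤ GrpCat.{u}) (η : 𝟭 GrpCat.{u} ⟶ ℓ), IsHQLocalizationFunctor ℓ η := by
  choose L instL η hη using fun G : GrpCat.{u} => exists_isHQLocalization G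
  have hloc : ∀ G H : GrpCat.{u}, IsLocalFor (η G) (L H) := fun G H =>
    (hη H).2.isLocalFor (hη G).1
  choose m hm _ using fun (G H : GrpCat.{u}) (f : G ⟶ H) => hloc G H ((η H).comp f.hom)
  let ℓ : GrpCat.{u} ⥤ GrpCat.{u} :=
    { obj := fun G => GrpCat.of (L G)
      map := fun f => GrpCat.ofHom (m _ _ f)
      map_id := fun G => by
        apply GrpCat.hom_ext
        exact (hloc G G).hom_ext (hm G G (𝟙 G))
      map_comp := fun {G H K} f g => by
        apply GrpCat.hom_ext
        refine (hloc G K).hom_ext ((hm G K (f ≫ g)).trans ?_)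
        change _ = ((m H K g).comp (m G H f)).comp (η G)
        rw [MonoidHom.comp_assoc, hm, ← MonoidHom.comp_assoc, hm, MonoidHom.comp_assoc]
        rfl }
  refine ⟨ℓ, { app := fun G => GrpCat.ofHom (η G), naturality := fun G H f => ?_ }, hη⟩
  apply GrpCat.hom_ext
  exact (hm G H f).symm

/-! ### The rational lower central series -/

section ratLCS

variable {L : Type u} [Group L]

instance rationalLowerCentralSeries_normal (n : ℕ) : (rationalLowerCentralSeries L n).Normal :=
  (ratSeries L n).2

theorem mem_rationalLowerCentralSeries_succ {n : ℕ} {x : L} :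
    x ∈ rationalLowerCentralSeries L (n + 1) ↔ x ∈ rationalLowerCentralSeries L n ∧
      ∃ m : ℕ, 1 ≤ m ∧ x ^ m ∈ ⁅rationalLowerCentralSeries L n, (⊤ : Subgroup L)⁆ :=
  have := (ratSeries L n).2
  mem_ratStep_iff (ratSeries L n).1 x

theorem rationalLowerCentralSeries_succ_le (n : ℕ) :
    rationalLowerCentralSeries L (n + 1) ≤ rationalLowerCentralSeries L n :=
  fun _ hx => (mem_rationalLowerCentralSeries_succ.1 hx).1

theorem commutator_rationalLowerCentralSeries_le (n : ℕ) :
    ⁅rationalLowerCentralSeries L n, (⊤ : Subgroup L)⁆ ≤ rationalLowerCentralSeries L (n + 1) :=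
  fun x hx => mem_rationalLowerCentralSeries_succ.2
    ⟨Subgroup.commutator_le_left _ _ hx, 1, le_rfl, by rwa [pow_one]⟩

theorem commutatorElement_mem_rationalLowerCentralSeries {n : ℕ} {x : L}
    (hx : x ∈ rationalLowerCentralSeries L n) (g : L) :
    ⁅x, g⁆ ∈ rationalLowerCentralSeries L (n + 1) :=
  commutator_rationalLowerCentralSeries_le n (Subgroup.commutator_mem_commutator hx trivial)

theorem lowerCentralSeries_le_rationalLowerCentralSeries (n : ℕ) :
    (⊤ : Subgroup L).lowerCentralSeries n ≤ rationalLowerCentralSeries L n := by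
  induction n with
  | zero => exact le_top
  | succ n ih =>
    exact (Subgroup.commutator_mono ih le_rfl).trans (commutator_rationalLowerCentralSeries_le n)

/-- Elements of the `n`-th term are central modulo the next term. -/
theorem mk_mem_center {n : ℕ} {x : L} (hx : x ∈ rationalLowerCentralSeries L n) :
    (x : L ⧸ rationalLowerCentralSeries L (n + 1)) ∈ Subgroup.center _ := by
  rw [Subgroup.mem_center_iff]
  intro g
  induction g using QuotientGroup.induction_on with | H g => ?_
  have h := (QuotientGroup.eq_one_iff _).2 (commutatorElement_mem_rationalLowerCentralSeries hx g)
  have h' : ⁅(x : L ⧸ rationalLowerCentralSeries L (n + 1)),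
      (g : L ⧸ rationalLowerCentralSeries L (n + 1))⁆ = 1 :=
    (map_commutatorElement (QuotientGroup.mk' _) x g).symm.trans h
  exact (commutatorElement_eq_one_iff_mul_comm.1 h').symm

/-- By induction `x⁻¹ * y` lies in the `n`-th term, hence is central modulo the next, and there its
`m`-th power is trivial. A further power then falls into the commutator subgroup, which is
membership in the next term. -/
theorem eq_of_pow_eq_of_rationalLowerCentralSeries (n : ℕ) :
    ∀ (x y : L ⧸ rationalLowerCentralSeries L n) (m : ℕ), 1 ≤ m → x ^ m = y ^ m → x = y := by
  induction n with
  | zero =>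
    intro x y m _ _
    induction x using QuotientGroup.induction_on with | H x => ?_
    induction y using QuotientGroup.induction_on with | H y => ?_
    exact QuotientGroup.eq.2 (Subgroup.mem_top _)
  | succ n ih =>
    intro x y m hm hxy
    induction x using QuotientGroup.induction_on with | H x => ?_
    induction y using QuotientGroup.induction_on with | H y => ?_
    have h1 : x⁻¹ * y ∈ rationalLowerCentralSeries L n := by
      rw [← QuotientGroup.eq]
      refine ih _ _ m hm ?_
      have : (x ^ m)⁻¹ * y ^ m ∈ rationalLowerCentralSeries L (n + 1) := QuotientGroup.eq.1 hxy
      exact QuotientGroup.eq.2 (rationalLowerCentralSeries_succ_le n this)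
    have hc : Commute (x : L ⧸ rationalLowerCentralSeries L (n + 1)) ((x⁻¹ * y : L) : L ⧸ _) :=
      Subgroup.mem_center_iff.1 (mk_mem_center h1) x
    have h2 : ((x⁻¹ * y : L) : L ⧸ rationalLowerCentralSeries L (n + 1)) ^ m = 1 := by
      have h3 := hc.mul_pow m
      rw [← QuotientGroup.mk_mul, mul_inv_cancel_left, ← hxy] at h3
      exact mul_eq_left.1 h3.symm
    have h4 : (x⁻¹ * y) ^ m ∈ rationalLowerCentralSeries L (n + 1) :=
      (QuotientGroup.eq_one_iff _).1 h2
    obtain ⟨-, k, hk, h5⟩ := mem_rationalLowerCentralSeries_succ.1 h4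
    rw [← pow_mul] at h5
    exact QuotientGroup.eq.2
      (mem_rationalLowerCentralSeries_succ.2 ⟨h1, m * k, Nat.mul_pos hm hk, h5⟩)

theorem IsRational.quotient_rationalLowerCentralSeries (hL : IsRational L) (n : ℕ) :
    IsRational (L ⧸ rationalLowerCentralSeries L n) := by
  intro m hm
  refine ⟨fun x y => eq_of_pow_eq_of_rationalLowerCentralSeries n x y m hm, fun x => ?_⟩
  induction x using QuotientGroup.induction_on with | H x => ?_
  obtain ⟨y, rfl⟩ := hL.exists_pow_eq hm x
  exact ⟨y, rfl⟩

theorem mem_rationalLowerCentralSeries_of_pow {n m : ℕ} (hm : 1 ≤ m) {x : L}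
    (hx : x ^ m ∈ rationalLowerCentralSeries L n) : x ∈ rationalLowerCentralSeries L n := by
  rw [← QuotientGroup.eq_one_iff]
  refine eq_of_pow_eq_of_rationalLowerCentralSeries n _ 1 m hm ?_
  rw [one_pow]
  exact (QuotientGroup.eq_one_iff _).2 hx

theorem lowerCentralSeries_quotient_eq_bot {n : ℕ} (H : Subgroup L) [H.Normal]
    (h : (⊤ : Subgroup L).lowerCentralSeries n ≤ H) :
    (⊤ : Subgroup (L ⧸ H)).lowerCentralSeries n = ⊥ := by
  rw [← Subgroup.map_top_of_surjective _ (QuotientGroup.mk'_surjective H),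
    ← Subgroup.map_lowerCentralSeries, Subgroup.map_eq_bot_iff, QuotientGroup.ker_mk']
  exact h

theorem isHQLocal_quotient_rationalLowerCentralSeries (hL : IsRational L) (n : ℕ) :
    IsHQLocal (L ⧸ rationalLowerCentralSeries L n) :=
  isHQLocal_of_lowerCentralSeries_eq_bot n _ (hL.quotient_rationalLowerCentralSeries n)
    (lowerCentralSeries_quotient_eq_bot _ (lowerCentralSeries_le_rationalLowerCentralSeries n))

/-- Applied to `R` modulo its center, induction sends the `n`-th term into the center of `R`.
Commutators with it therefore die, and uniqueness of roots in `R` kills the next term. -/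
theorem rationalLowerCentralSeries_le_ker (n : ℕ) : ∀ (R : Type u) [Group R], IsRational R →
    (⊤ : Subgroup R).lowerCentralSeries n = ⊥ → ∀ φ : L →* R,
      rationalLowerCentralSeries L n ≤ φ.ker := by
  induction n with
  | zero =>
    intro R _ _ h φ x _
    have h' : (⊤ : Subgroup R) = ⊥ := h
    rw [MonoidHom.mem_ker, ← Subgroup.mem_bot, ← h']
    trivial
  | succ n ih =>
    intro R _ hR h φ x hx
    obtain ⟨-, m, hm, hxm⟩ := mem_rationalLowerCentralSeries_succ.1 hx
    have hc : ∀ y ∈ rationalLowerCentralSeries L n, φ y ∈ Subgroup.center R := by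
      intro y hy
      have := ih _ hR.quotient_center (lowerCentralSeries_quotient_center h)
        ((QuotientGroup.mk' _).comp φ) hy
      exact (QuotientGroup.eq_one_iff _).1 this
    have h1 : ⁅rationalLowerCentralSeries L n, (⊤ : Subgroup L)⁆ ≤ φ.ker := by
      refine Subgroup.commutator_le.2 fun y hy g _ => ?_
      rw [MonoidHom.mem_ker, map_commutatorElement, commutatorElement_eq_one_iff_mul_comm]
      exact (Subgroup.mem_center_iff.1 (hc y hy) (φ g)).symm
    refine hR.pow_injective hm ?_
    rw [← map_pow, one_pow]
    exact h1 hxm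

end ratLCS

/-! ### The stages of the `ℚ`-completion of a local group -/

theorem lowerCentralSeries_bau_nilQuot (G : Type u) [Group G] (n : ℕ) :
    (⊤ : Subgroup (Bau (NilQuot G n))).lowerCentralSeries n = ⊥ := by
  refine lowerCentralSeries_eq_bot_of_rootClosure n _ (Bau.isRational _) (Bau.of _).range
    Bau.eq_top_of_rootClosed ?_
  rw [MonoidHom.range_eq_map, ← Subgroup.map_lowerCentralSeries,
    lowerCentralSeries_quotient_eq_bot _ le_rfl, Subgroup.map_bot]

/-- The image contains that of `G` and is closed under roots, as `L` has roots and the target has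
unique ones. -/
theorem stage_surjective {G L : Type u} [Group G] [Group L] {η : G →* L}
    (hη : IsHQLocalization η) {n : ℕ} {φ : L →* Bau (NilQuot G n)}
    (hφ : ∀ g, φ (η g) = Bau.of (NilQuot G n) (QuotientGroup.mk g)) :
    Function.Surjective φ := by
  rw [← MonoidHom.range_eq_top]
  refine Bau.eq_top_of_rootClosed _ ?_ ?_
  · rintro _ ⟨x, rfl⟩
    induction x using QuotientGroup.induction_on with | H x => ?_
    exact ⟨η x, hφ x⟩
  · rintro n x ⟨y, hy⟩
    obtain ⟨z, rfl⟩ := hη.2.isRational.exists_pow_eq (Nat.le_add_left 1 n) y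
    rw [map_pow] at hy
    exact ⟨z, (Bau.isRational _).pow_injective (Nat.le_add_left 1 n) hy⟩

theorem stage_ker {G L : Type u} [Group G] [Group L] {η : G →* L}
    (hη : IsHQLocalization η) {n : ℕ} {φ : L →* Bau (NilQuot G n)}
    (hφ : ∀ g, φ (η g) = Bau.of (NilQuot G n) (QuotientGroup.mk g)) :
    φ.ker = rationalLowerCentralSeries L n := by
  apply le_antisymm
  · let π := QuotientGroup.mk' (rationalLowerCentralSeries L n)
    have hL := hη.2.isRational.quotient_rationalLowerCentralSeries n
    let h : NilQuot G n →* L ⧸ rationalLowerCentralSeries L n :=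
      QuotientGroup.lift _ (π.comp η) fun g hg => by
        refine (QuotientGroup.eq_one_iff _).2
          (lowerCentralSeries_le_rationalLowerCentralSeries n ?_)
        have := Subgroup.mem_map_of_mem η hg
        rw [Subgroup.map_lowerCentralSeries] at this
        exact Subgroup.lowerCentralSeries_mono n le_top this
    -- The quotient of `L` is rational and nilpotent, hence local, so two maps from `L` into it
    -- agree once they agree on `G`. Thus the projection factors through `φ`, which bounds its
    -- kernel.
    have key : (Bau.lift hL h).comp φ = π :=
      ((isHQLocal_quotient_rationalLowerCentralSeries hη.2.isRational n).isLocalFor hη.1).hom_ext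
        (by
          ext g
          change Bau.lift hL h (φ (η g)) = π (η g)
          rw [hφ]
          rfl)
    intro x hx
    have h1 : π x = 1 := by
      rw [← key, MonoidHom.comp_apply, MonoidHom.mem_ker.1 hx, map_one]
    exact (QuotientGroup.eq_one_iff _).1 h1
  · exact rationalLowerCentralSeries_le_ker n _ (Bau.isRational _)
      (lowerCentralSeries_bau_nilQuot G n) φ

/-! ### Groups with finite dimensional first rational homology -/

/-- A family of elements generates a group up to roots and commutators. -/
def GeneratesRationally {L : Type u} [Group L] {r : ℕ} (g : Fin r → L) : Prop :=
  ∀ D : Subgroup L, (∀ (n : ℕ) (x : L), 1 ≤ n → x ^ n ∈ D → x ∈ D) → commutator L ≤ D →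
    (∀ i, g i ∈ D) → D = ⊤

/-- The class of a `1`-chain in rational homology, as a linear map. -/
noncomputable def clsLin (G : Type u) [Group G] :
    (G →₀ QQ.{u}) →ₗ[QQ.{u}] rationalHomology G 1 :=
  (groupHomology.H1π (trivQ G)).hom ∘ₗ LinearMap.codRestrict _ LinearMap.id fun x => by
    rw [groupHomology.cycles₁_eq_top_of_isTrivial]; trivial

theorem clsLin_apply {G : Type u} [Group G] (x : G →₀ QQ.{u}) : clsLin G x = cls₁ x := rfl

/-- Classes of group elements span `H₁`, so finitely many of them do; every homomorphism to a
rational vector space factors linearly through `H₁`. -/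
theorem exists_finite_detecting (G : Type u) [Group G]
    (hG : FiniteDimensional (ULift.{u} ℚ) (rationalHomology G 1)) :
    ∃ (r : ℕ) (g : Fin r → G), ∀ (V : Type u) [AddCommGroup V] [Module QQ.{u} V]
      (θ : G →* Multiplicative V), (∀ i, θ (g i) = 1) → θ = 1 := by
  classical
  have hspan : Submodule.span QQ.{u} (Set.range fun g : G => clsLin G (Finsupp.single g 1)) = ⊤ := by
    rw [eq_top_iff]
    intro x _
    obtain ⟨x, rfl⟩ := cls₁_surjective x
    rw [← clsLin_apply]
    clear * -
    induction x using Finsupp.induction_linear with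
    | zero => rw [map_zero]; exact zero_mem _
    | add x y hx hy => rw [map_add]; exact add_mem hx hy
    | single g a =>
      rw [← mul_one a, ← smul_eq_mul, ← Finsupp.smul_single, map_smul]
      exact Submodule.smul_mem _ _ (Submodule.subset_span ⟨g, rfl⟩)
  have hfg : (Submodule.span QQ.{u}
      (Set.range fun g : G => clsLin G (Finsupp.single g 1))).FG := by
    rw [hspan]; exact Module.Finite.fg_top
  obtain ⟨s, hs, hss⟩ := Submodule.fg_span_iff_fg_span_finset_subset _ |>.1 hfg
  choose e he using fun x : s => hs x.2
  refine ⟨s.card, fun i => e (s.equivFin.symm i), fun V _ _ θ hθ => ?_⟩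
  let t₀ := lin₁ (fun g => (θ g).toAdd)
  obtain ⟨t, ht⟩ := exists_linear_factor (clsLin G) t₀ (fun x hx => by
    have h0 : cls₁ x = cls₁ 0 := hx.trans (map_zero (clsLin G)).symm
    obtain ⟨z, hz⟩ := (cls₁_eq_iff _ _).1 h0
    rw [sub_zero] at hz
    rw [hz]
    exact linear_ext₂ (a := t₀ ∘ₗ bd₂ G) (b := 0) (fun b b' => by
        simp only [t₀, LinearMap.comp_apply, bd₂_single, map_add, map_sub,
          Finsupp.linearCombination_single, one_smul, map_mul, toAdd_mul, LinearMap.zero_apply]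
        abel) z)
  have ht0 : t = 0 := by
    refine LinearMap.ext_on_range (v := fun x : s => (x : rationalHomology G 1)) ?_ fun x => ?_
    · rw [Subtype.range_coe_subtype]
      exact hss.symm.trans hspan
    · rw [← he x]
      refine (ht _).trans ?_
      rw [Finsupp.linearCombination_single, one_smul]
      have h1 : θ (e (s.equivFin.symm (s.equivFin x))) = 1 := hθ (s.equivFin x)
      rw [Equiv.symm_apply_apply] at h1
      rw [h1]
      rfl
  ext g
  have h1 := ht (Finsupp.single g 1)
  rw [ht0, Finsupp.linearCombination_single, one_smul] at h1
  exact h1.symm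

/-- The map from `L` to the rationalized abelian quotient `L ⧸ D` vanishes on the generators, hence
on `G`, hence on `L` because `η` is rationally 2-acyclic. So every element has a power in the
root-closed subgroup `D`. -/
theorem generatesRationally_of_detecting {G L : Type u} [Group G] [Group L] {η : G →* L}
    (hη : IsHQMap η) {r : ℕ} {g : Fin r → G}
    (hg : ∀ (V : Type u) [AddCommGroup V] [Module QQ.{u} V] (θ : G →* Multiplicative V),
      (∀ i, θ (g i) = 1) → θ = 1) : GeneratesRationally fun i => η (g i) := by
  intro D hroot hcomm hgD
  have : D.Normal := ⟨fun d hd x => by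
    have h1 : ⁅x, d⁆ ∈ D := hcomm (Subgroup.commutator_mem_commutator trivial trivial)
    have h2 := D.mul_mem h1 hd
    rwa [commutatorElement_def, inv_mul_cancel_right] at h2⟩
  let : CommGroup (L ⧸ D) :=
    { mul_comm := by
        rintro ⟨a⟩ ⟨b⟩
        refine QuotientGroup.eq.2 ?_
        have h1 : ⁅b⁻¹, a⁻¹⁆ ∈ D := hcomm (Subgroup.commutator_mem_commutator trivial trivial)
        rw [commutatorElement_def] at h1
        simpa [mul_assoc] using h1 }
  let θ : L →* Multiplicative (ℚ ⊗[ℤ] Additive (L ⧸ D)) :=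
    (toRat (L ⧸ D)).comp (QuotientGroup.mk' D)
  have h1 : θ.comp η = 1 := hg _ _ fun i => by
    have : QuotientGroup.mk' D (η (g i)) = 1 := (QuotientGroup.eq_one_iff _).2 (hgD i)
    change toRat (L ⧸ D) (QuotientGroup.mk' D (η (g i))) = 1
    rw [this, map_one]
  have h2 : θ = 1 := by
    obtain ⟨ψ, -, hu⟩ := isHQMap_iff_isOrtho.1 hη _ _ _
      (isRatCentralExt_toPUnit (ℚ ⊗[ℤ] Additive (L ⧸ D))) 1 1 rfl
    exact (hu θ ⟨h1, rfl⟩).trans (hu 1 ⟨rfl, rfl⟩).symm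
  rw [eq_top_iff]
  intro x _
  obtain ⟨m, hm, hx⟩ := (toRat_eq_one_iff (QuotientGroup.mk' D x)).1 (DFunLike.congr_fun h2 x)
  exact hroot m x hm ((QuotientGroup.eq_one_iff _).1 hx)

/-! ### Commutators with generators -/

section bracket

variable {L : Type u} [Group L]

theorem mul_commutatorElement_of_center {Q : Type u} [Group Q] {x k g : Q}
    (h : ⁅k, g⁆ ∈ Subgroup.center Q) : ⁅x * k, g⁆ = ⁅x, g⁆ * ⁅k, g⁆ := by
  have h1 := Subgroup.mem_center_iff.1 h
  have : ⁅x * k, g⁆ = x * ⁅k, g⁆ * x⁻¹ * ⁅x, g⁆ := by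
    simp only [commutatorElement_def]; group
  rw [this, h1 x, mul_inv_cancel_right, ← h1]

theorem commutatorElement_mul_of_center {Q : Type u} [Group Q] {k g g' : Q}
    (h : ⁅k, g'⁆ ∈ Subgroup.center Q) : ⁅k, g * g'⁆ = ⁅k, g⁆ * ⁅k, g'⁆ := by
  have h1 := Subgroup.mem_center_iff.1 h
  have : ⁅k, g * g'⁆ = ⁅k, g⁆ * (g * ⁅k, g'⁆ * g⁻¹) := by
    simp only [commutatorElement_def]; group
  rw [this, h1 g, mul_inv_cancel_right]

theorem mk_commutatorElement_mem_center {n : ℕ} {k : L} (hk : k ∈ rationalLowerCentralSeries L n)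
    (g : L) : ⁅(k : L ⧸ rationalLowerCentralSeries L (n + 2)),
      (g : L ⧸ rationalLowerCentralSeries L (n + 2))⁆ ∈ Subgroup.center _ :=
  mk_mem_center (commutatorElement_mem_rationalLowerCentralSeries hk g)

instance centerCommGroup (Q : Type u) [Group Q] : CommGroup (Subgroup.center Q) where
  mul_comm a b := Subtype.ext (Subgroup.mem_center_iff.1 b.2 a)

/-- The commutator pairing of the `n`-th term of the rational lower central series with the
group, modulo the `n + 2`-nd term. -/
noncomputable def bracket (n : ℕ) : rationalLowerCentralSeries L n →* L →*
    Subgroup.center (L ⧸ rationalLowerCentralSeries L (n + 2)) :=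
  MonoidHom.mk' (fun k => MonoidHom.mk'
    (fun g => ⟨⁅(k.1 : L ⧸ rationalLowerCentralSeries L (n + 2)),
      (g : L ⧸ rationalLowerCentralSeries L (n + 2))⁆, mk_commutatorElement_mem_center k.2 g⟩)
    fun g g' => Subtype.ext (commutatorElement_mul_of_center
      (g := (g : L ⧸ rationalLowerCentralSeries L (n + 2)))
      (mk_commutatorElement_mem_center k.2 g')))
    fun k l => MonoidHom.ext fun g => Subtype.ext (mul_commutatorElement_of_center
      (x := (k.1 : L ⧸ rationalLowerCentralSeries L (n + 2)))
      (mk_commutatorElement_mem_center l.2 g))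

/-- The product of the brackets with a family of elements. -/
noncomputable def bracketProd (n : ℕ) {r : ℕ} (g : Fin r → L) :
    (Fin r → rationalLowerCentralSeries L n) →*
    Subgroup.center (L ⧸ rationalLowerCentralSeries L (n + 2)) where
  toFun k := ∏ i, bracket n (k i) (g i)
  map_one' := Finset.prod_eq_one fun i _ => by rw [Pi.one_apply, map_one, MonoidHom.one_apply]
  map_mul' k k' := by
    rw [← Finset.prod_mul_distrib]
    exact Finset.prod_congr rfl fun i _ => by rw [Pi.mul_apply, map_mul, MonoidHom.mul_apply]

theorem exists_pow_eq_rationalLowerCentralSeries (hL : IsRational L) {n m : ℕ} (hm : 1 ≤ m)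
    (k : rationalLowerCentralSeries L n) : ∃ k' : rationalLowerCentralSeries L n, k' ^ m = k := by
  obtain ⟨x, hx⟩ := hL.exists_pow_eq hm k.1
  exact ⟨⟨x, mem_rationalLowerCentralSeries_of_pow hm (hx ▸ k.2)⟩, Subtype.ext hx⟩

/-- The elements `l` satisfying this for all `k` form a subgroup containing the generators. It
contains commutators because the target is abelian, and it is root-closed because a power on `l` can
be moved to `k`, which has roots. -/
theorem bracket_mem_range (hL : IsRational L) {r : ℕ} {g : Fin r → L}
    (hg : GeneratesRationally g) (n : ℕ) (k : rationalLowerCentralSeries L n) (l : L) :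
    bracket n k l ∈ (bracketProd n g).range := by
  classical
  let D : Subgroup L := ⨅ k, (bracketProd n g).range.comap (bracket n k)
  have hD : ∀ {x}, x ∈ D ↔ ∀ k, bracket n k x ∈ (bracketProd n g).range := fun {x} => by
    simp only [D, Subgroup.mem_iInf, Subgroup.mem_comap]
  have h : D = ⊤ := by
    refine hg D (fun m x hm hx => hD.2 fun k => ?_) ?_ fun i => hD.2 fun k => ?_
    · obtain ⟨k, rfl⟩ := exists_pow_eq_rationalLowerCentralSeries hL hm k
      rw [map_pow, MonoidHom.pow_apply, ← map_pow]
      exact hD.1 hx k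
    · refine Subgroup.commutator_le.2 fun x _ y _ => hD.2 fun k => ?_
      rw [map_commutatorElement, commutatorElement_eq_one_iff_mul_comm.2 (mul_comm _ _)]
      exact one_mem _
    · refine ⟨Pi.mulSingle i k, ?_⟩
      refine (Finset.prod_eq_single i (fun j _ hj => ?_) fun h => absurd (Finset.mem_univ i) h).trans
        ?_
      · rw [Pi.mulSingle_eq_of_ne hj, map_one, MonoidHom.one_apply]
      · rw [Pi.mulSingle_eq_same]
  exact hD.1 (h ▸ Subgroup.mem_top l) k

/-- Some power `z ^ m` is a product of commutators, hence of brackets with the generators. Taking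
`m`-th roots of the entries `k i` and using unique roots in the quotient recovers `z`. -/
theorem exists_bracketProd_eq (hL : IsRational L) {r : ℕ} {g : Fin r → L}
    (hg : GeneratesRationally g) {n : ℕ} {z : L} (hz : z ∈ rationalLowerCentralSeries L (n + 1)) :
    ∃ k, (bracketProd n g k : L ⧸ rationalLowerCentralSeries L (n + 2)) = z := by
  obtain ⟨-, m, hm, hzm⟩ := mem_rationalLowerCentralSeries_succ.1 hz
  have hle : ⁅rationalLowerCentralSeries L n, (⊤ : Subgroup L)⁆ ≤
      ((bracketProd n g).range.map (Subgroup.subtype _)).comap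
        (QuotientGroup.mk' (rationalLowerCentralSeries L (n + 2))) :=
    Subgroup.commutator_le.2 fun k hk l _ =>
      ⟨bracket n ⟨k, hk⟩ l, bracket_mem_range hL hg n ⟨k, hk⟩ l,
        (map_commutatorElement (QuotientGroup.mk' _) k l).symm⟩
  obtain ⟨_, ⟨k, rfl⟩, hk⟩ := hle hzm
  choose k' hk' using fun i => exists_pow_eq_rationalLowerCentralSeries hL hm (k i)
  have hkk : k = k' ^ m := funext fun i => (hk' i).symm
  refine ⟨k', eq_of_pow_eq_of_rationalLowerCentralSeries _ _ _ m hm ?_⟩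
  rw [hkk, map_pow] at hk
  exact hk

/-! ### Products of commutators with a fixed family -/

/-- The product of the commutators of two families. -/
def commProd {G : Type u} [Group G] {r : ℕ} (x g : Fin r → G) : G :=
  (List.ofFn fun i => ⁅x i, g i⁆).prod

theorem map_commProd {G H : Type u} [Group G] [Group H] (f : G →* H) {r : ℕ} (x g : Fin r → G) :
    f (commProd x g) = commProd (fun i => f (x i)) fun i => f (g i) := by
  rw [commProd, map_list_prod, List.map_ofFn, commProd]
  congr 2
  funext i
  exact map_commutatorElement f _ _

theorem prod_ofFn_mul_center {Q : Type u} [Group Q] {r : ℕ} (a : Fin r → Q)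
    (b : Fin r → Subgroup.center Q) :
    (List.ofFn fun i => a i * (b i : Q)).prod = (List.ofFn a).prod * ((∏ i, b i : _) : Q) := by
  induction r with
  | zero => simp
  | succ r ih =>
    rw [List.ofFn_succ, List.prod_cons, ih, List.ofFn_succ, List.prod_cons, Fin.prod_univ_succ,
      Subgroup.coe_mul]
    have := Subgroup.mem_center_iff.1 (b 0).2
    rw [mul_assoc, mul_assoc, ← mul_assoc (b 0 : Q), ← this, mul_assoc]

/-- Modulo the term of index `n + 2`, each correction `k i` changes its commutator by a central
factor, and central factors can be collected at the end. -/
theorem mk_commProd_mul {r : ℕ} (g x : Fin r → L) {n : ℕ}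
    (k : Fin r → rationalLowerCentralSeries L n) :
    ((commProd (fun i => x i * k i) g : L) : L ⧸ rationalLowerCentralSeries L (n + 2)) =
      ((commProd x g : L) : L ⧸ rationalLowerCentralSeries L (n + 2)) *
        (bracketProd n g k : L ⧸ rationalLowerCentralSeries L (n + 2)) := by
  have h := prod_ofFn_mul_center
    (fun i => ⁅(x i : L ⧸ rationalLowerCentralSeries L (n + 2)),
      (g i : L ⧸ rationalLowerCentralSeries L (n + 2))⁆)
    (fun i => bracket n (k i) (g i))
  refine Eq.trans ?_ (h.trans ?_)
  · refine (map_commProd (QuotientGroup.mk' _) _ _).trans ?_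
    rw [commProd]
    congr 2
    funext i
    exact mul_commutatorElement_of_center
      (x := (x i : L ⧸ rationalLowerCentralSeries L (n + 2)))
      (mk_commutatorElement_mem_center (k i).2 (g i))
  · congr 1
    exact (map_commProd (QuotientGroup.mk' (rationalLowerCentralSeries L (n + 2))) x g).symm

end bracket

/-! ### Systems of equations in local groups -/

/-- Let `X` be `K` with a universal solution adjoined. Unknowns enter the right-hand sides only
through commutators, which do not see central changes; hence `K → X` lifts uniquely against central
extensions, and locality of `K` gives a unique retraction, i.e. a unique solution. -/
theorem IsHQLocal.existsUnique_solution {K : Type u} [Group K] (hK : IsHQLocal K) {Y : Type u}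
    {r : ℕ} (x : Y → K) (s : Y → Fin r → Y) (g : Fin r → K) :
    ∃! t : Y → K, ∀ y, t y = x y * commProd (fun i => t (s y i)) g := by
  let P := Monoid.Coprod K (FreeGroup Y)
  let R : Y → P := fun y => (Monoid.Coprod.inr (FreeGroup.of y))⁻¹ * (Monoid.Coprod.inl (x y) *
    commProd (fun i => Monoid.Coprod.inr (FreeGroup.of (s y i))) fun i => Monoid.Coprod.inl (g i))
  let X := P ⧸ Subgroup.normalClosure (Set.range R)
  let j : K →* X := (QuotientGroup.mk' _).comp Monoid.Coprod.inl
  let τ : Y → X := fun y => QuotientGroup.mk' _ (Monoid.Coprod.inr (FreeGroup.of y))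
  have hτ : ∀ y, τ y = j (x y) * commProd (fun i => τ (s y i)) fun i => j (g i) := by
    intro y
    have : QuotientGroup.mk' (Subgroup.normalClosure (Set.range R)) (R y) = 1 :=
      (QuotientGroup.eq_one_iff _).2 (Subgroup.subset_normalClosure ⟨y, rfl⟩)
    rw [map_mul, map_inv, inv_mul_eq_one, map_mul, map_commProd] at this
    exact this
  have hlift : ∀ {E : Type u} [Group E] (φ : K →* E) (e : Y → E),
      (∀ y, e y = φ (x y) * commProd (fun i => e (s y i)) fun i => φ (g i)) →
      ∃ ψ : X →* E, ψ.comp j = φ ∧ ∀ y, ψ (τ y) = e y := by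
    intro E _ φ e he
    let ψ₀ : P →* E := Monoid.Coprod.lift φ (FreeGroup.lift e)
    have hl : ∀ a, ψ₀ (Monoid.Coprod.inl a) = φ a := fun a => Monoid.Coprod.lift_apply_inl _ _ _
    have hr : ∀ y, ψ₀ (Monoid.Coprod.inr (FreeGroup.of y)) = e y := fun y =>
      (Monoid.Coprod.lift_apply_inr _ _ _).trans FreeGroup.lift_apply_of
    have hker : Subgroup.normalClosure (Set.range R) ≤ ψ₀.ker := by
      refine Subgroup.normalClosure_le_normal ?_
      rintro _ ⟨y, rfl⟩
      change ψ₀ _ = 1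
      rw [map_mul, map_inv, map_mul, map_commProd]
      simp only [hl, hr]
      rw [inv_mul_eq_one]
      exact he y
    exact ⟨QuotientGroup.lift _ ψ₀ hker, MonoidHom.ext hl, hr⟩
  have hext : ∀ {E : Type u} [Group E] {ψ ψ' : X →* E}, ψ.comp j = ψ'.comp j →
      (∀ y, ψ (τ y) = ψ' (τ y)) → ψ = ψ' := by
    intro E _ ψ ψ' h1 h2
    apply QuotientGroup.monoidHom_ext
    apply Monoid.Coprod.hom_ext
    · exact h1
    · apply FreeGroup.ext_hom
      exact h2
  have hj : IsHQMap j := by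
    rw [isHQMap_iff_isOrtho]
    intro E C _ _ p hp φ χ hsq
    have hsq' : ∀ a, p (φ a) = χ (j a) := fun a => DFunLike.congr_fun hsq a
    choose e₀ he₀ using fun y => hp.surjective (χ (τ y))
    have hcongr : ∀ e e' : Y → E, (∀ y, p (e y) = p (e' y)) → ∀ y,
        commProd (fun i => e (s y i)) (fun i => φ (g i)) =
          commProd (fun i => e' (s y i)) fun i => φ (g i) := by
      intro e e' hee y
      rw [commProd, commProd]
      congr 2
      funext i
      have hk : e' (s y i) * (e (s y i))⁻¹ ∈ Subgroup.center E := hp.central (by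
        rw [MonoidHom.mem_ker, map_mul, map_inv, hee, mul_inv_cancel])
      have h1 : ⁅e' (s y i) * (e (s y i))⁻¹, φ (g i)⁆ = 1 :=
        commutatorElement_eq_one_iff_mul_comm.2 (Subgroup.mem_center_iff.1 hk _).symm
      have hk' : e' (s y i) = e (s y i) * (e' (s y i) * (e (s y i))⁻¹) := by
        rw [Subgroup.mem_center_iff.1 hk, inv_mul_cancel_right]
      rw [hk', mul_commutatorElement_of_center (by rw [h1]; exact one_mem _), h1, mul_one]
    -- Substituting arbitrary lifts `e₀` once into the right-hand sides already gives an exact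
    -- solution: `e` and `e₀` agree modulo the central kernel, so they have the same commutators.
    let e : Y → E := fun y => φ (x y) * commProd (fun i => e₀ (s y i)) fun i => φ (g i)
    have he : ∀ y, p (e y) = χ (τ y) := by
      intro y
      rw [hτ, map_mul, map_mul, map_commProd, map_commProd]
      simp only [he₀, hsq']
    obtain ⟨ψ, hψ1, hψ2⟩ := hlift φ e fun y => by
      rw [hcongr e e₀ fun y => (he y).trans (he₀ y).symm]
    refine ⟨ψ, ⟨hψ1, hext ?_ fun y => ?_⟩, fun ψ' hψ' => hext (hψ'.1.trans hψ1.symm) fun y => ?_⟩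
    · rw [MonoidHom.comp_assoc, hψ1, hsq]
    · rw [MonoidHom.comp_apply, hψ2, he]
    · have h1 : ∀ a, ψ' (j a) = φ a := fun a => DFunLike.congr_fun hψ'.1 a
      have h2 : ∀ y, p (ψ' (τ y)) = χ (τ y) := fun y => DFunLike.congr_fun hψ'.2 (τ y)
      rw [hψ2, hτ, map_mul, map_commProd]
      simp only [h1]
      rw [hcongr (fun y => ψ' (τ y)) e₀ fun y => (h2 y).trans (he₀ y).symm]
  -- Solutions in `K` correspond to retractions of `j`.
  obtain ⟨ψ, hψ, hψu⟩ := hK.isLocalFor hj (MonoidHom.id K)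
  have hψ' : ∀ a, ψ (j a) = a := fun a => DFunLike.congr_fun hψ a
  refine ⟨fun y => ψ (τ y), fun y => ?_, fun t ht => ?_⟩
  · change ψ (τ y) = _
    rw [hτ, map_mul, map_commProd]
    simp only [hψ']
  · obtain ⟨χ, hχ, hχt⟩ := hlift (MonoidHom.id K) t ht
    funext y
    rw [← hχt, hψu χ hχ]

/-! ### The homomorphism from the localization to the `ℚ`-completion -/

section comparison

variable {G L : Type u} [Group G] [Group L] {η : G →* L} {β : L →* QCompletion G}

theorem ker_eq_iInf_rationalLowerCentralSeries (hη : IsHQLocalization η)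
    (hβ : β.comp η = QCompletion.of G) : β.ker = ⨅ n, rationalLowerCentralSeries L n := by
  have hφ : ∀ n, ((QCompletion.proj G n).comp β).ker = rationalLowerCentralSeries L n := fun n =>
    stage_ker hη fun g => congrArg (QCompletion.proj G n) (DFunLike.congr_fun hβ g)
  ext x
  simp only [Subgroup.mem_iInf, ← hφ, MonoidHom.mem_ker]
  exact ⟨fun h n => congrArg (QCompletion.proj G n) h, fun h => Subtype.ext (funext h)⟩

/-- Successive approximation: an expression correct at one stage is corrected at the next by entries
deep in the rational lower central series, so the entries converge in the completion, though perhaps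
not in `L`. -/
theorem exists_eq_commProd (hη : IsHQLocalization η) (hβ : β.comp η = QCompletion.of G) {r : ℕ}
    {g : Fin r → L} (hg : GeneratesRationally g) (y : QCompletion G)
    (hy : QCompletion.proj G 1 y = 1) :
    ∃ s : Fin r → QCompletion G, y = commProd s fun i => β (g i) := by
  let φ : ∀ n, L →* Bau (NilQuot G n) := fun n => (QCompletion.proj G n).comp β
  have hφ : ∀ n g, φ n (η g) = Bau.of (NilQuot G n) (QuotientGroup.mk g) := fun n g =>
    congrArg (QCompletion.proj G n) (DFunLike.congr_fun hβ g)
  have hcompat : ∀ n x, Bau.map (NilQuot.proj G n) (φ (n + 1) x) = φ n x := fun n x => (β x).2 n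
  have hker : ∀ n x, φ n x = 1 ↔ x ∈ rationalLowerCentralSeries L n := fun n x => by
    rw [← stage_ker hη (hφ n), MonoidHom.mem_ker]
  have step : ∀ n (x : Fin r → L), φ (n + 1) (commProd x g) = y.1 (n + 1) →
      ∃ x' : Fin r → L, φ (n + 2) (commProd x' g) = y.1 (n + 2) ∧ ∀ i, φ n (x' i) = φ n (x i) := by
    intro n x hx
    obtain ⟨l, hl⟩ := stage_surjective hη (hφ (n + 2)) (y.1 (n + 2))
    have hz : (commProd x g)⁻¹ * l ∈ rationalLowerCentralSeries L (n + 1) := by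
      rw [← hker, map_mul, map_inv, hx, ← hcompat, hl, y.2 (n + 1), inv_mul_cancel]
    obtain ⟨k, hk⟩ := exists_bracketProd_eq hη.2.isRational hg hz
    refine ⟨fun i => x i * k i, ?_, fun i => ?_⟩
    · have h1 := mk_commProd_mul g x k
      rw [hk, ← QuotientGroup.mk_mul, mul_inv_cancel_left, eq_comm, QuotientGroup.eq, ← hker,
        map_mul, map_inv, inv_mul_eq_one, hl] at h1
      exact h1.symm
    · rw [map_mul, (hker n _).2 (k i).2, mul_one]
  choose! next hnext hnext' using step
  -- The `n`-th approximation is correct at stage `n + 1`; the trivial family is a valid start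
  -- because `y` is trivial at stage `1`. Later corrections leave stage `n` of the entries
  -- unchanged.
  let x : ℕ → Fin r → L := fun n => Nat.rec (fun _ => 1) (fun n x => next n x) n
  have hx : ∀ n, φ (n + 1) (commProd (x n) g) = y.1 (n + 1) := by
    intro n
    induction n with
    | zero =>
      have h1 : commProd (x 0) g = 1 := by
        rw [commProd]
        refine List.prod_eq_one fun a ha => ?_
        obtain ⟨i, rfl⟩ := (List.mem_ofFn' _ _).1 ha
        exact commutatorElement_one_left _
      rw [h1, map_one]
      exact hy.symm
    | succ n ih => exact hnext n (x n) ih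
  refine ⟨fun i => ⟨fun n => φ n (x n i), fun n => ?_⟩, ?_⟩
  · rw [hcompat]
    exact hnext' n (x n) (hx n) i
  · refine Subtype.ext (funext fun n => ?_)
    refine Eq.trans ?_ (map_commProd (QCompletion.proj G n) _ _).symm
    have h1 : y.1 n = φ n (commProd (x n) g) := by
      rw [← hcompat, hx, y.2]
    rw [h1, map_commProd]
    rfl

theorem surjective_of_finiteDimensional (hη : IsHQLocalization η)
    (hβ : β.comp η = QCompletion.of G)
    (hG : FiniteDimensional (ULift.{u} ℚ) (rationalHomology G 1)) : Function.Surjective β := by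
  obtain ⟨r, g₀, hg₀⟩ := exists_finite_detecting G hG
  have hg := generatesRationally_of_detecting hη.1 hg₀
  have hY : ∀ y : QCompletion G, ∃ (x : L) (s : Fin r → QCompletion G),
      y = β x * commProd s fun i => β (η (g₀ i)) := by
    intro y
    have hφ : ∀ g, ((QCompletion.proj G 1).comp β) (η g) =
        Bau.of (NilQuot G 1) (QuotientGroup.mk g) := fun g =>
      congrArg (QCompletion.proj G 1) (DFunLike.congr_fun hβ g)
    obtain ⟨x, hx⟩ := stage_surjective hη hφ (QCompletion.proj G 1 y)
    have hx' : QCompletion.proj G 1 (β x) = QCompletion.proj G 1 y := hx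
    obtain ⟨s, hs⟩ := exists_eq_commProd hη hβ hg ((β x)⁻¹ * y) (by
      rw [map_mul, map_inv, hx', inv_mul_cancel])
    exact ⟨x, s, by rw [← hs, mul_inv_cancel_left]⟩
  -- This is a system with one unknown for each element of the completion. It is solved in `L` with
  -- constants `x y`, and in the completion with constants `β (x y)`.
  choose x s hxs using hY
  obtain ⟨t, ht, -⟩ := hη.2.existsUnique_solution x s fun i => η (g₀ i)
  obtain ⟨t', -, ht'⟩ := (QCompletion.isHQLocal G).existsUnique_solution (fun y => β (x y)) s
    fun i => β (η (g₀ i))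
  -- Both the image of the solution in `L` and the identity solve the system in the completion,
  -- where the solution is unique.
  have h1 : (fun y => β (t y)) = id := (ht' _ fun y => by
    rw [ht y, map_mul, map_commProd]).trans (ht' _ hxs).symm
  exact fun y => ⟨t y, congrFun h1 y⟩

end comparison

theorem IsHQLocalizationFunctor.existsUnique_bau {ℓ : GrpCat.{u} ⥤ GrpCat.{u}}
    {η : 𝟭 GrpCat.{u} ⟶ ℓ} (hη : IsHQLocalizationFunctor ℓ η) :
    ∃! α : bau.{u} ⟶ ℓ, bauUnit ≫ α = η := by
  have hrat : ∀ G : GrpCat.{u}, IsRational (ℓ.obj G) := fun G => (hη G).2.isRational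
  refine ⟨{ app := fun G => GrpCat.ofHom (Bau.lift (hrat G) (η.app G).hom)
            naturality := fun G H f => ?_ }, ?_, fun α hα => ?_⟩
  · apply GrpCat.hom_ext
    apply Bau.hom_ext (hrat H)
    exact congrArg GrpCat.Hom.hom (η.naturality f)
  · ext G : 2
    rfl
  · ext G : 2
    apply GrpCat.hom_ext
    apply Bau.hom_ext (hrat G)
    exact congrArg GrpCat.Hom.hom (congrArg (fun γ => γ.app G) hα)

theorem IsHQLocalizationFunctor.exists_qCompletion {ℓ : GrpCat.{u} ⥤ GrpCat.{u}}
    {η : 𝟭 GrpCat.{u} ⟶ ℓ} (hη : IsHQLocalizationFunctor ℓ η) :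
    ∃ β : ℓ ⟶ qCompletion.{u}, η ≫ β = qCompletionUnit ∧
      ∀ β' : ℓ ⟶ qCompletion.{u}, η ≫ β' = qCompletionUnit → β' = β := by
  have hloc : ∀ G H : GrpCat.{u}, IsLocalFor (η.app G).hom (QCompletion H) := fun G H =>
    (QCompletion.isHQLocal H).isLocalFor (hη G).1
  choose b hb _ using fun G : GrpCat.{u} => hloc G G (QCompletion.of G)
  refine ⟨{ app := fun G => GrpCat.ofHom (b G), naturality := fun G H f => ?_ }, ?_,
    fun β' hβ' => ?_⟩
  · apply GrpCat.hom_ext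
    apply (hloc G H).hom_ext
    change ((b H).comp (ℓ.map f).hom).comp (η.app G).hom =
      ((QCompletion.map f.hom).comp (b G)).comp (η.app G).hom
    have h1 : (ℓ.map f).hom.comp (η.app G).hom = (η.app H).hom.comp f.hom :=
      (congrArg GrpCat.Hom.hom (η.naturality f)).symm
    rw [MonoidHom.comp_assoc, h1, ← MonoidHom.comp_assoc, hb, MonoidHom.comp_assoc, hb]
    rfl
  · ext G : 2
    apply GrpCat.hom_ext
    exact hb G
  · ext G : 2
    apply GrpCat.hom_ext
    apply (hloc G G).hom_ext
    exact (congrArg GrpCat.Hom.hom (congrArg (fun γ => γ.app G) hβ')).trans (hb G).symm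

end RatGrp

theorem mainTheorem1 :
    -- every Hℚ-local group is rational
    (∀ (L : Type u) [Group L], IsHQLocal L → IsRational L) ∧
    -- every rational nilpotent group is Hℚ-local
    (∀ (N : Type u) [Group N], Group.IsNilpotent N → IsRational N → IsHQLocal N) ∧
    -- so are limits of rational nilpotent groups
    (∀ (J : Type v) [Category.{w} J] (F : J ⥤ GrpCat.{u}),
      (∀ j, Group.IsNilpotent (F.obj j) ∧ IsRational (F.obj j)) →
      ∀ c : Limits.Cone F, Nonempty (Limits.IsLimit c) → IsHQLocal c.pt) ∧
    -- and the ℚ-completion of any group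
    (∀ (G : Type u) [Group G], IsHQLocal (QCompletion G)) ∧
    -- the Hℚ-localization functor exists
    (∃ (ℓ : GrpCat.{u} ⥤ GrpCat.{u}) (η : 𝟭 GrpCat.{u} ⟶ ℓ), IsHQLocalizationFunctor ℓ η) ∧
    -- and, for any choice of it, there are canonical natural transformations Bau → ℓ → ℚ-completion
    ∀ (ℓ : GrpCat.{u} ⥤ GrpCat.{u}) (η : 𝟭 GrpCat.{u} ⟶ ℓ), IsHQLocalizationFunctor ℓ η →
      (∃! α : bau.{u} ⟶ ℓ, bauUnit ≫ α = η) ∧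
      ∃ β : ℓ ⟶ qCompletion.{u}, η ≫ β = qCompletionUnit ∧
        (∀ β' : ℓ ⟶ qCompletion.{u}, η ≫ β' = qCompletionUnit → β' = β) ∧
        ∀ G : GrpCat.{u}, FiniteDimensional (ULift.{u} ℚ) (rationalHomology G 1) →
          Function.Surjective (β.app G).hom ∧
          (β.app G).hom.ker = ⨅ n : ℕ, rationalLowerCentralSeries (ℓ.obj G) n := by
  refine ⟨fun L _ hL => hL.isRational, isHQLocal_of_isNilpotent, fun J _ F hF c hc => ?_,
    QCompletion.isHQLocal, exists_isHQLocalizationFunctor, fun ℓ η hη => ?_⟩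
  · exact isHQLocal_of_isLimit F (fun j => isHQLocal_of_isNilpotent _ (hF j).1 (hF j).2) c
      hc.some
  · refine ⟨hη.existsUnique_bau, ?_⟩
    obtain ⟨β, hβ, hβu⟩ := hη.exists_qCompletion
    refine ⟨β, hβ, hβu, fun G hG => ?_⟩
    have h : (β.app G).hom.comp (η.app G).hom = QCompletion.of G :=
      congrArg GrpCat.Hom.hom (congrArg (fun γ => γ.app G) hβ)
    exact ⟨surjective_of_finiteDimensional (hη G) h hG,
      ker_eq_iInf_rationalLowerCentralSeries (hη G) h⟩
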